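/- Let $N\ge 1$ and let $(A_m)_{m\in\mathbb Z}$ be complex $N\times N$ matrices with $\sum_m\|A_m\|<\infty$ and $A_{-m}=A_m^*$. Let $H_0$ be the bounded self-adjoint operator on $\mathcal H=\ell^2(\mathbb Z,\mathbb C^N)$ given by $(H_0\psi)_n=\sum_m A_{n-m}\psi_m$, and let $h(p)=\sum_m A_m e^{imp}$, $p\in\mathbb T=\mathbb R/2\pi\mathbb Z$. Assume that $h$ (as a function of $e^{ip}$) extends holomorphically to an annulus $1/r<|z|<r$ for some $r>1$. Let $\lambda_1,\dots,\lambda_N$ be real $2\pi$-periodic functions giving the repeated eigenvalues of $h(p)$, and $W_1,\dots,W_N$ $2\pi$-periodic functions giving a corresponding orthonormal basis of eigenvectors, all analytic on $(-\pi,\pi)$ and coinciding there with smooth functions on $\mathbb R$ (so piecewise smooth on $\mathbb R$). Let $$\kappa(h)=\bigcup_{j=1}^N\{\lambda_j(p)\;:\;p\in\mathbb T,\ \lambda_j\text{ is not differentiable at }p\text{, or }\lambda_j'(p)=0\}.$$ Let $\mathcal U:\mathcal H\to\bigoplus_{j=1}^N L^2(\mathbb T)$ be the unitary operator $(\mathcal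 U\psi)_j(p)=\langle W_j(p),\sum_n\psi_ne^{inp}\rangle$, where $\mathbb T$ carries the measure $dp/2\pi$. Let $\Delta$ be a compact interval with $\Delta\cap\kappa(h)=\emptyset$, let $I\supset\Delta$ be an open interval with $\overline I\cap\kappa(h)=\emptyset$, and let $\zeta:\mathbb R\to\mathbb R$ be smooth, supported in $\overline I$ and equal to $1$ on $\Delta$. Put $F_j=\zeta(\lambda_j)\,\lambda_j'/|\lambda_j'|^2$ (understood as $0$ where $\zeta(\lambda_j)=0$), let $a_j$ be the closure in $L^2(\mathbb T)$ of the operator $iF_j\frac{d}{dp}+\frac i2F_j'$ defined on $C^\infty(\mathbb T)$, and let $\mathbb A=\mathbb A_\Delta=\mathcal U^{-1}\big(\bigoplus_j a_j\big)\,\mathcal U$. For a bounded operator $S$ on $\mathcal H$, "$S$ is of class $C^1(\mathbb A)$" means that $t\mapsto e^{-i\mathbb At}Se^{i\mathbb At}$ is strongly of class $C^1$, and $[S,i\mathbb A]$ denotes the bounded operator, if it exists, that extends the form $(\varphi,\psi)\mapsto i\big(\langle\varphi,S\mathbb A\psi\rangle-\langle\mathbb A\varphi,S\psi\rangle\big)$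 on $D(\mathbb A)$. For a bounded self-adjoint operator $H$, $E_H(\cdot)$ is its spectral measure. Theorem. The operator $\mathbb A$ is self-adjoint. Let $V$ be a compact self-adjoint operator on $\mathcal H$ of class $C^1(\mathbb A)$ such that $[V,i\mathbb A]$ is compact, and let $H=H_0+V$. Then $[H,i\mathbb A]$ exists as a bounded operator, and there is a compact operator $K$ such that $$E_H(\Delta)\,[H,i\mathbb A]\,E_H(\Delta)=E_H(\Delta)+K .$$ Moreover $\Delta$ contains at most finitely many eigenvalues of $H$, counted with multiplicity. -/

import Mathlib

open Real Set Filter Topology MeasureTheory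
open scoped ENNReal ContDiff InnerProductSpace

noncomputable section

namespace BlockLaurent

/-! ### The Hilbert space of sequences and the Laurent operator -/

/-- `ℂ^N` with its Euclidean norm. -/
abbrev Vec (N : ℕ) : Type := EuclideanSpace ℂ (Fin N)

/-- `ℓ²(ℤ, ℂ^N)`. -/
abbrev Seq (N : ℕ) : Type := lp (fun _ : ℤ => Vec N) 2

/-- `N × N` complex matrices. -/
abbrev Mat (N : ℕ) : Type := Matrix (Fin N) (Fin N) ℂ

/-- The Euclidean operator norm of a matrix. -/
def opNorm {N : ℕ} (B : Mat N) : ℝ := ‖Matrix.toEuclideanCLM (𝕜 := ℂ) B‖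

theorem summable_sq {N : ℕ} (ψ : Seq N) : Summable fun n => ‖ψ n‖ ^ (2 : ℝ) := by
  simpa using (memℓp_gen_iff (p := 2) (by norm_num)).1 (lp.memℓp ψ)

theorem norm_sq_eq {N : ℕ} (ψ : Seq N) : ‖ψ‖ ^ (2 : ℝ) = ∑' n, ‖ψ n‖ ^ (2 : ℝ) := by
  simpa using lp.norm_rpow_eq_tsum (p := 2) (by norm_num) ψ

theorem blockShift_bound {N : ℕ} (m : ℤ) (B : Mat N) (ψ : Seq N) (n : ℤ) :
    ‖Matrix.toEuclideanCLM (𝕜 := ℂ) B (ψ (n - m))‖ ^ (2 : ℝ)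
      ≤ opNorm B ^ (2 : ℝ) * ‖ψ (n - m)‖ ^ (2 : ℝ) := by
  have h0 : 0 ≤ opNorm B := norm_nonneg _
  have h1 : ‖Matrix.toEuclideanCLM (𝕜 := ℂ) B (ψ (n - m))‖ ≤ opNorm B * ‖ψ (n - m)‖ :=
    ContinuousLinearMap.le_opNorm _ _
  exact (Real.rpow_le_rpow (norm_nonneg _) h1 (by norm_num)).trans_eq
    (Real.mul_rpow h0 (norm_nonneg _))

theorem summable_shift {N : ℕ} (m : ℤ) (ψ : Seq N) :
    Summable fun n => ‖ψ (n - m)‖ ^ (2 : ℝ) :=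
  (Equiv.subRight m).summable_iff.2 (summable_sq ψ)

theorem blockShift_mem {N : ℕ} (m : ℤ) (B : Mat N) (ψ : Seq N) :
    Memℓp (fun n => Matrix.toEuclideanCLM (𝕜 := ℂ) B (ψ (n - m))) 2 := by
  refine (memℓp_gen_iff (p := 2) (by norm_num)).2 ?_
  simpa using Summable.of_nonneg_of_le (fun n => by positivity) (blockShift_bound m B ψ)
    ((summable_shift m ψ).mul_left _)

/-- The bounded operator `(ψ_n) ↦ (B ψ_{n-m})` on `ℓ²(ℤ, ℂ^N)`. -/
def blockShift {N : ℕ} (m : ℤ) (B : Mat N) : Seq N →L[ℂ] Seq N :=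
  LinearMap.mkContinuous
    { toFun := fun ψ =>
        ⟨fun n => Matrix.toEuclideanCLM (𝕜 := ℂ) B (ψ (n - m)), blockShift_mem m B ψ⟩
      map_add' := fun ψ η => by ext1; funext n; simp; rfl
      map_smul' := fun c ψ => by ext1; funext n; simp }
    (opNorm B) (fun ψ => by
      have h0 : 0 ≤ opNorm B := norm_nonneg _
      refine (Real.rpow_le_rpow_iff (norm_nonneg _) (by positivity)
        (by norm_num : (0 : ℝ) < 2)).1 ?_
      rw [norm_sq_eq, Real.mul_rpow h0 (norm_nonneg _), norm_sq_eq, ← tsum_mul_left]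
      refine le_trans (Summable.tsum_le_tsum (blockShift_bound m B ψ) ?_
        ((summable_shift m ψ).mul_left _)) (le_of_eq ?_)
      · exact Summable.of_nonneg_of_le (fun n => by positivity) (blockShift_bound m B ψ)
          ((summable_shift m ψ).mul_left _)
      · exact (Equiv.subRight m).tsum_eq (fun n => opNorm B ^ (2 : ℝ) * ‖ψ n‖ ^ (2 : ℝ)))

theorem blockShift_apply {N : ℕ} (m : ℤ) (B : Mat N) (ψ : Seq N) (n : ℤ) :
    blockShift m B ψ n = Matrix.toEuclideanCLM (𝕜 := ℂ) B (ψ (n - m)) := rfl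

theorem norm_blockShift_le {N : ℕ} (m : ℤ) (B : Mat N) : ‖blockShift m B‖ ≤ opNorm B :=
  LinearMap.mkContinuous_norm_le _ (norm_nonneg _) _

/-- The block Laurent operator `H₀` with coefficients `A`, as the sum of the operators
`(ψ_n) ↦ (A_m ψ_{n-m})`, which converges in norm when `∑ ‖A_m‖ < ∞`. -/
def laurent {N : ℕ} (A : ℤ → Mat N) : Seq N →L[ℂ] Seq N := ∑' m, blockShift m (A m)

/-- `(H₀ ψ)_n = ∑_m A_{n-m} ψ_m`. -/
theorem laurent_apply {N : ℕ} (A : ℤ → Mat N) (hA : Summable fun m => opNorm (A m))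
    (ψ : Seq N) (n : ℤ) :
    HasSum (fun m => Matrix.toEuclideanCLM (𝕜 := ℂ) (A (n - m)) (ψ m)) (laurent A ψ n) := by
  have hs : Summable fun m => blockShift m (A m) :=
    Summable.of_norm_bounded hA fun m => norm_blockShift_le m (A m)
  have h1 : HasSum (fun m => blockShift m (A m) ψ) (laurent A ψ) :=
    hs.hasSum.mapL (ContinuousLinearMap.apply ℂ (Seq N) ψ)
  have h2 : HasSum (fun m => blockShift m (A m) ψ n) (laurent A ψ n) :=
    h1.mapL (lp.evalCLM ℂ (fun _ : ℤ => Vec N) 2 n)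
  have h3 := (Equiv.subLeft n).hasSum_iff.2 h2
  convert h3 using 2 with m
  simp [blockShift_apply]

/-! ### The circle, the symbol and its eigenvalues -/

instance twoPiPos : Fact (0 < 2 * π) := ⟨Real.two_pi_pos⟩

/-- `𝕋 = ℝ/2πℤ`; functions on `𝕋` are the `2π`-periodic functions `p ↦ f (p : 𝕋)` on `ℝ`. -/
abbrev Torus : Type := AddCircle (2 * π)

/-- `L²(𝕋)` with the normalised measure `dp/2π`. -/
abbrev L2T : Type := Lp ℂ 2 (AddCircle.haarAddCircle (T := 2 * π))

/-- The symbol `h(p) = ∑_m A_m e^{imp}`; note that `fourier m p = e^{imp}` on `ℝ/2πℤ`. -/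
def symbol {N : ℕ} (A : ℤ → Mat N) (p : Torus) : Mat N := ∑' m : ℤ, fourier m p • A m

/-- `h` has a holomorphic extension to an annulus `1/r < |z| < r` about the unit circle. -/
def HasHolomorphicExtension {N : ℕ} (h : Torus → Mat N) : Prop :=
  ∃ r : ℝ, 1 < r ∧ ∃ g : ℂ → Mat N,
    (∀ a b, DifferentiableOn ℂ (fun z => g z a b) {z : ℂ | 1 / r < ‖z‖ ∧ ‖z‖ < r}) ∧
    ∀ p : ℝ, g (Complex.exp (Complex.I * p)) = h (p : Torus)

/-- A `2π`-periodic function which is analytic on `(-π, π)` and is there the restriction of a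
smooth function on `ℝ` (so it is piecewise smooth on `ℝ`, with possible breaks at the odd
multiples of `π` only). -/
def PiecewiseRegular {E : Type*} [NormedAddCommGroup E] [NormedSpace ℝ E] (f : Torus → E) :
    Prop :=
  AnalyticOnNhd ℝ (fun p : ℝ => f (p : Torus)) (Ioo (-π) π) ∧
    ∃ g : ℝ → E, ContDiff ℝ ∞ g ∧ ∀ p ∈ Ioo (-π) π, f (p : Torus) = g p

/-- `lam` are the repeated eigenvalues of `h(p)` and `W` is a corresponding orthonormal basis of
eigenvectors, chosen to be analytic on `(-π, π)` and piecewise smooth as periodic functions. -/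
structure IsEigensystem {N : ℕ} (h : Torus → Mat N) (lam : Fin N → Torus → ℝ)
    (W : Fin N → Torus → Vec N) : Prop where
  orthonormal : ∀ p, Orthonormal ℂ fun j => W j p
  eigen : ∀ p j, Matrix.toEuclideanCLM (𝕜 := ℂ) (h p) (W j p) = (lam j p : ℂ) • W j p
  regular_lam : ∀ j, PiecewiseRegular (lam j)
  regular_W : ∀ j, PiecewiseRegular (W j)

/-- The critical values of one eigenvalue branch: its values at the points of the circle where it
is not differentiable or has zero derivative. -/
def criticalValues (l : Torus → ℝ) : Set ℝ :=
  {x | ∃ p : ℝ, l (p : Torus) = x ∧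
    (¬ DifferentiableAt ℝ (fun q : ℝ => l (q : Torus)) p ∨
      deriv (fun q : ℝ => l (q : Torus)) p = 0)}

/-- The critical set `κ(h)`, the union of the sets of critical values of the branches. -/
def criticalSet {N : ℕ} (lam : Fin N → Torus → ℝ) : Set ℝ := ⋃ j, criticalValues (lam j)

/-! ### The conjugate operator -/

/-- The function `F = ζ(λ) λ' / |λ'|²`, as a `2π`-periodic function on `ℝ`. -/
def field (ζ : ℝ → ℝ) (l : Torus → ℝ) (p : ℝ) : ℝ :=
  ζ (l (p : Torus)) * (deriv (fun q : ℝ => l (q : Torus)) p /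
    |deriv (fun q : ℝ => l (q : Torus)) p| ^ 2)

/-- A statement on `2π`-periodic functions of `p` that holds for almost every `p`. -/
theorem ae_coe {P : Torus → Prop} (h : ∀ᵐ x ∂(AddCircle.haarAddCircle (T := 2 * π)), P x) :
    ∀ᵐ p ∂(volume.restrict (Ioc (-π) π)), P ((p : ℝ) : Torus) := by
  have hv : ∀ᵐ x ∂(volume : Measure Torus), P x := by
    rw [AddCircle.volume_eq_smul_haarAddCircle]
    exact Measure.ae_smul_measure h _
  have hm := AddCircle.measurePreserving_mk (2 * π) (-π)
  rw [show -π + 2 * π = π by ring] at hm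
  exact hm.quasiMeasurePreserving.ae hv

/-- The graph of `φ ↦ i F φ' + (i/2) F' φ` on smooth `2π`-periodic functions `φ`, in `L²(𝕋)`. -/
def branchGraph (F : ℝ → ℝ) : Submodule ℂ (L2T × L2T) where
  carrier := {x | ∃ φ : ℝ → ℂ, ContDiff ℝ ∞ φ ∧ Function.Periodic φ (2 * π) ∧
    (∀ᵐ p ∂(volume.restrict (Ioc (-π) π)), x.1 ((p : ℝ) : Torus) = φ p) ∧
    ∀ᵐ p ∂(volume.restrict (Ioc (-π) π)), x.2 ((p : ℝ) : Torus) =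
      Complex.I * F p * deriv φ p + Complex.I / 2 * (deriv F p : ℝ) * φ p}
  add_mem' := by
    rintro x y ⟨φ, hφ, pφ, h1, h2⟩ ⟨χ, hχ, pχ, k1, k2⟩
    refine ⟨φ + χ, hφ.add hχ, pφ.add pχ, ?_, ?_⟩
    · filter_upwards [h1, k1, ae_coe (Lp.coeFn_add x.1 y.1)] with p a b c
      rw [Prod.fst_add, c, Pi.add_apply, a, b, Pi.add_apply]
    · filter_upwards [h2, k2, ae_coe (Lp.coeFn_add x.2 y.2)] with p a b c
      rw [Prod.snd_add, c, Pi.add_apply, a, b, deriv_add (hφ.differentiable (by simp) p)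
        (hχ.differentiable (by simp) p), Pi.add_apply]
      ring
  zero_mem' := by
    refine ⟨0, contDiff_const, fun _ => rfl, ?_, ?_⟩
    · filter_upwards [ae_coe (Lp.coeFn_zero ℂ 2 AddCircle.haarAddCircle)] with p c
      exact c
    · filter_upwards [ae_coe (Lp.coeFn_zero ℂ 2 AddCircle.haarAddCircle)] with p c
      refine Eq.trans c ?_
      simp
  smul_mem' := by
    rintro c x ⟨φ, hφ, pφ, h1, h2⟩
    refine ⟨fun p => c * φ p, contDiff_const.mul hφ, fun p => by simp only [pφ p], ?_, ?_⟩
    · filter_upwards [h1, ae_coe (Lp.coeFn_smul c x.1)] with p a d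
      rw [Prod.smul_fst, d, Pi.smul_apply, a, smul_eq_mul]
    · filter_upwards [h2, ae_coe (Lp.coeFn_smul c x.2)] with p a d
      rw [Prod.smul_snd, d, Pi.smul_apply, a, smul_eq_mul,
        deriv_const_mul c (hφ.differentiable (by simp) p)]
      ring

/-- The operator `a = (i/2) (F d/dp + d/dp F) = i F d/dp + (i/2) F'` in `L²(𝕋)`: the closure of
its restriction to smooth periodic functions. -/
def branchOp (F : ℝ → ℝ) : L2T →ₗ.[ℂ] L2T := (branchGraph F).toLinearPMap.closure

/-- The sequence of the `a`-th components. -/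
def component {N : ℕ} (a : Fin N) (ψ : Seq N) : lp (fun _ : ℤ => ℂ) 2 :=
  ⟨fun n => ψ n a, by
    refine (memℓp_gen_iff (p := 2) (by norm_num)).2 ?_
    simpa using Summable.of_nonneg_of_le (fun n => by positivity)
      (fun n => Real.rpow_le_rpow (norm_nonneg _) (PiLp.norm_apply_le (ψ n) a) (by norm_num))
      (summable_sq ψ)⟩

/-- The Fourier transform `ψ̂(p) = ∑_n ψ_n e^{inp}`, the series being summed in `L²`
component by component. -/
def fourierTransform {N : ℕ} (ψ : Seq N) (p : Torus) : Vec N :=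
  WithLp.toLp 2 fun a => (fourierBasis.repr.symm (component a ψ) : L2T) p

/-- The `j`-th component `f_j(p) = ⟨W_j(p), ψ̂(p)⟩` of the unitary map
`𝓤 : ℓ²(ℤ, ℂ^N) → ⨁_j L²(𝕋)`. -/
def diagonalize {N : ℕ} (W : Fin N → Torus → Vec N) (j : Fin N) (ψ : Seq N) (p : Torus) : ℂ :=
  inner ℂ (W j p) (fourierTransform ψ p)

theorem fourierTransform_add {N : ℕ} (ψ η : Seq N) :
    ∀ᵐ p ∂(AddCircle.haarAddCircle (T := 2 * π)),
      fourierTransform (ψ + η) p = fourierTransform ψ p + fourierTransform η p := by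
  have h : ∀ a : Fin N, ∀ᵐ p ∂(AddCircle.haarAddCircle (T := 2 * π)),
      (fourierBasis.repr.symm (component a (ψ + η)) : L2T) p
        = (fourierBasis.repr.symm (component a ψ) : L2T) p
          + (fourierBasis.repr.symm (component a η) : L2T) p := fun a => by
    have e : component a (ψ + η) = component a ψ + component a η := rfl
    rw [e, map_add]
    exact Lp.coeFn_add _ _
  filter_upwards [ae_all_iff.2 h] with p hp
  ext a
  exact hp a

theorem fourierTransform_smul {N : ℕ} (c : ℂ) (ψ : Seq N) :
    ∀ᵐ p ∂(AddCircle.haarAddCircle (T := 2 * π)),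
      fourierTransform (c • ψ) p = c • fourierTransform ψ p := by
  have h : ∀ a : Fin N, ∀ᵐ p ∂(AddCircle.haarAddCircle (T := 2 * π)),
      (fourierBasis.repr.symm (component a (c • ψ)) : L2T) p
        = c • (fourierBasis.repr.symm (component a ψ) : L2T) p := fun a => by
    have e : component a (c • ψ) = c • component a ψ := rfl
    rw [e, map_smul]
    exact Lp.coeFn_smul _ _
  filter_upwards [ae_all_iff.2 h] with p hp
  ext a
  exact hp a

/-- The graph of `𝔸 = 𝓤⁻¹ (⨁_j a_j) 𝓤`, where `a_j` is built from `F_j = ζ(λ_j) λ_j' / |λ_j'|²`: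
it consists of the pairs `(ψ, η)` with `((𝓤ψ)_j, (𝓤η)_j)` in the graph of `a_j` for all `j`. -/
def conjugateGraph {N : ℕ} (lam : Fin N → Torus → ℝ) (W : Fin N → Torus → Vec N) (ζ : ℝ → ℝ) :
    Submodule ℂ (Seq N × Seq N) where
  carrier := {x | ∀ j, ∃ y ∈ (branchOp (field ζ (lam j))).graph,
    y.1 =ᵐ[AddCircle.haarAddCircle] diagonalize W j x.1 ∧
    y.2 =ᵐ[AddCircle.haarAddCircle] diagonalize W j x.2}
  add_mem' := by
    intro x x' h h' j
    obtain ⟨y, hy, h1, h2⟩ := h j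
    obtain ⟨y', hy', h1', h2'⟩ := h' j
    refine ⟨y + y', Submodule.add_mem _ hy hy', ?_, ?_⟩
    · filter_upwards [h1, h1', Lp.coeFn_add y.1 y'.1, fourierTransform_add x.1 x'.1]
        with p a b c d
      rw [Prod.fst_add, c, Pi.add_apply, a, b, Prod.fst_add, diagonalize, diagonalize,
        diagonalize, d, inner_add_right]
    · filter_upwards [h2, h2', Lp.coeFn_add y.2 y'.2, fourierTransform_add x.2 x'.2]
        with p a b c d
      rw [Prod.snd_add, c, Pi.add_apply, a, b, Prod.snd_add, diagonalize, diagonalize,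
        diagonalize, d, inner_add_right]
  zero_mem' := by
    intro j
    refine ⟨0, Submodule.zero_mem _, ?_, ?_⟩ <;>
    · filter_upwards [Lp.coeFn_zero ℂ 2 AddCircle.haarAddCircle,
        fourierTransform_smul (N := N) 0 0] with p c d
      refine Eq.trans c ?_
      rw [zero_smul, zero_smul] at d
      simp [diagonalize, d]
  smul_mem' := by
    intro c x h j
    obtain ⟨y, hy, h1, h2⟩ := h j
    refine ⟨c • y, Submodule.smul_mem _ c hy, ?_, ?_⟩
    · filter_upwards [h1, Lp.coeFn_smul c y.1, fourierTransform_smul c x.1] with p a b d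
      rw [Prod.smul_fst, b, Pi.smul_apply, a, Prod.smul_fst, diagonalize, diagonalize, d,
        inner_smul_right, smul_eq_mul]
    · filter_upwards [h2, Lp.coeFn_smul c y.2, fourierTransform_smul c x.2] with p a b d
      rw [Prod.smul_snd, b, Pi.smul_apply, a, Prod.smul_snd, diagonalize, diagonalize, d,
        inner_smul_right, smul_eq_mul]

/-- The conjugate operator `𝔸 = 𝓤⁻¹ (⨁_j a_j) 𝓤`. -/
def conjugateOp {N : ℕ} (lam : Fin N → Torus → ℝ) (W : Fin N → Torus → Vec N) (ζ : ℝ → ℝ) :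
    Seq N →ₗ.[ℂ] Seq N := (conjugateGraph lam W ζ).toLinearPMap

/-! ### Unitary groups, the class `C¹(A)`, commutators and spectral projections -/

section Abstract

variable {E : Type*} [NormedAddCommGroup E] [InnerProductSpace ℂ E] [CompleteSpace E]

/-- `U` is the strongly continuous unitary group `t ↦ e^{iAt}`: its infinitesimal generator is
`iA`, with the exact domain. -/
structure IsUnitaryGroup (A : E →ₗ.[ℂ] E) (U : ℝ → E →L[ℂ] E) : Prop where
  mem_unitary : ∀ t, U t ∈ unitary (E →L[ℂ] E)
  map_add : ∀ s t, U (s + t) = U s * U t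
  continuous : ∀ ψ, Continuous fun t => U t ψ
  generator : ∀ ψ η, (ψ, η) ∈ A.graph ↔ HasDerivAt (fun t => U t ψ) (Complex.I • η) 0

open Classical in
/-- `e^{iAt}` for a self-adjoint operator `A`: the unitary group with generator `iA`, which exists
and is unique in that case (the value is `0` if there is no such group). -/
def expI (A : E →ₗ.[ℂ] E) : ℝ → E →L[ℂ] E :=
  if h : ∃ U, IsUnitaryGroup A U then h.choose else 0

/-- The class `C¹(A)`: the map `t ↦ e^{-iAt} S e^{iAt}` is strongly of class `C¹`. -/
def IsOfClassC1 (A : E →ₗ.[ℂ] E) (S : E →L[ℂ] E) : Prop :=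
  ∀ ψ, ContDiff ℝ 1 fun t : ℝ => expI A (-t) (S (expI A t ψ))

/-- `C` is the bounded operator `[S, iA]`: it extends the sesquilinear form
`(φ, ψ) ↦ ⟨φ, S iA ψ⟩ - ⟨φ, iA S ψ⟩ := i (⟨φ, S A ψ⟩ - ⟨A φ, S ψ⟩)` on the domain of `A`.
For densely defined `A` there is at most one such `C`. -/
def IsCommutator (A : E →ₗ.[ℂ] E) (S C : E →L[ℂ] E) : Prop :=
  ∀ φ ψ : A.domain, inner ℂ (φ : E) (C ψ)
    = Complex.I * (inner ℂ (φ : E) (S (A ψ)) - inner ℂ (A φ) (S ψ))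

/-- The spectral subspace of a bounded self-adjoint operator `H` for a closed set `s ⊆ ℝ`: the
vectors killed by `f(H)` for every continuous `f` that vanishes on `s`. This is the range of the
spectral measure `E_H(s)`, since `f(H)ψ = 0` for all these `f` means that the measure
`⟨ψ, E_H(·)ψ⟩` is carried by `s`. -/
def spectralSubspace (H : E →L[ℂ] E) (s : Set ℝ) : Submodule ℂ E :=
  ⨅ f : {f : ℝ → ℝ // Continuous f ∧ ∀ x ∈ s, f x = 0},
    LinearMap.ker (cfc f.1 H : E →L[ℂ] E).toLinearMap

instance spectralSubspace_hasOrthogonalProjection (H : E →L[ℂ] E) (s : Set ℝ) :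
    (spectralSubspace H s).HasOrthogonalProjection := by
  have hc : IsClosed (spectralSubspace H s : Set E) := by
    rw [spectralSubspace, Submodule.coe_iInf]
    exact isClosed_iInter fun f => ContinuousLinearMap.isClosed_ker (cfc f.1 H : E →L[ℂ] E)
  have : CompleteSpace (spectralSubspace H s) := hc.completeSpace_coe
  infer_instance

/-- The spectral projection `E_H(s)` of a bounded self-adjoint operator, for closed `s ⊆ ℝ`. -/
def spectralProj (H : E →L[ℂ] E) (s : Set ℝ) : E →L[ℂ] E :=
  (spectralSubspace H s).starProjection

end Abstract

end BlockLaurent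

end

namespace BlockLaurent

/-! ### Self-adjoint operators through their graphs -/

/-! The unitary `𝓤` turns `H₀` into multiplication by the `λ_j` and `𝔸` into the first order
operators `a_j = iF_j d/dp + (i/2)F_j'`. Since `[λ_j, i a_j] = F_j λ_j' = ζ(λ_j)`, one gets `[H₀,
i𝔸] = ζ(H₀)` (`isCommutator_laurent`), a bounded operator. With `H = H₀ + V` the commutator is
`ζ(H₀) + [V, i𝔸]`. The difference `ζ(H₀) - ζ(H)` is compact, by polynomial approximation, and `ζ(H)
E_H(Δ) = E_H(Δ)`, so compressing by `E_H(Δ)` leaves `E_H(Δ)` plus a compact operator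
(`exists_compact_mourre`).

For the eigenvalues, the virial theorem (`inner_commutator_eq_zero`) says that `[H, i𝔸]` has zero
expectation in every eigenvector. For eigenvalues in `Δ` the Mourre identity then reads `⟨ψ, Kψ⟩ =
-‖ψ‖²`, which a compact `K` allows on no infinite orthonormal family of eigenvectors
(`finite_eigenvalues_of_mourre`).

Self-adjointness of `a_j` is proved in the Fourier basis by mollifying with `(1 + iεD)⁻¹`, `D` being
the diagonal operator with entries `k`; its commutator with multiplication by `F` is `O(ε)`
(`resolvent_mul_sub`, `trigGraph_adjoint_le`). This needs `F_j` to be `C¹` up to the ends of `[-π,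
π]` with equal end values. The branches may jump or be permuted at `p = π`, but the characteristic
polynomial of `h` is continuous there; counting eigenvalues shows that a branch with a noncritical
one-sided limit at `π` continues differentiably across it (`boundary_of_notMem`,
`exists_isRegularField`). -/

theorem isCommutator_iff_graph {E : Type*} [NormedAddCommGroup E] [InnerProductSpace ℂ E]
    (A : E →ₗ.[ℂ] E) (S C : E →L[ℂ] E) :
    IsCommutator A S C ↔ ∀ x y x' y', (x, y) ∈ A.graph → (x', y') ∈ A.graph →
      inner ℂ x (C x') = Complex.I * (inner ℂ x (S y') - inner ℂ y (S x')) := by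
  constructor
  · intro h x y x' y' hx hx'
    obtain ⟨u, rfl, rfl⟩ := (LinearPMap.mem_graph_iff A).1 hx
    obtain ⟨v, rfl, rfl⟩ := (LinearPMap.mem_graph_iff A).1 hx'
    exact h u v
  · intro h u v
    exact h _ _ _ _ (A.mem_graph u) (A.mem_graph v)

section Graphs

variable {E : Type*} [NormedAddCommGroup E] [InnerProductSpace ℂ E] [CompleteSpace E]

theorem adjoint_graph_eq_of_isSelfAdjoint {A : E →ₗ.[ℂ] E} (hA : IsSelfAdjoint A) :
    A.graph.adjoint = A.graph := by
  rw [← LinearPMap.adjoint_graph_eq_graph_adjoint hA.dense_domain,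
    LinearPMap.isSelfAdjoint_def.1 hA]

theorem isSelfAdjoint_of_adjoint_graph_eq {A : E →ₗ.[ℂ] E} (hd : Dense (A.domain : Set E))
    (hA : A.graph.adjoint = A.graph) : IsSelfAdjoint A := by
  rw [LinearPMap.isSelfAdjoint_def]
  apply LinearPMap.eq_of_eq_graph
  rw [LinearPMap.adjoint_graph_eq_graph_adjoint hd, hA]

theorem inner_graph_symm {A : E →ₗ.[ℂ] E} (hA : IsSelfAdjoint A) {x y x' y' : E}
    (h : (x, y) ∈ A.graph) (h' : (x', y') ∈ A.graph) : inner ℂ y x' = inner ℂ x y' := by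
  rw [← adjoint_graph_eq_of_isSelfAdjoint hA] at h'
  exact sub_eq_zero.1 ((Submodule.mem_adjoint_iff _ _).1 h' x y h)

theorem inner_I_mul_self_re {A : E →ₗ.[ℂ] E} (hA : IsSelfAdjoint A) {x y : E}
    (h : (x, y) ∈ A.graph) (ε : ℝ) : RCLike.re (inner ℂ x ((Complex.I * ε) • y)) = 0 := by
  have h1 := inner_graph_symm hA h h
  have h2 : (starRingEnd ℂ) (inner ℂ x y) = inner ℂ x y := by rw [inner_conj_symm, h1]
  have h3 := Complex.conj_eq_iff_im.1 h2
  rw [inner_smul_right]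
  simp [h3]

/-- Pythagoras: `⟨x, Ax⟩` is real, so `x` and `iεAx` are orthogonal for the real inner product. The
two bounds below serve as the resolvent estimates. -/
theorem norm_add_I_smul_sq {A : E →ₗ.[ℂ] E} (hA : IsSelfAdjoint A) {x y : E}
    (h : (x, y) ∈ A.graph) (ε : ℝ) :
    ‖x + (Complex.I * ε) • y‖ ^ 2 = ‖x‖ ^ 2 + (|ε| * ‖y‖) ^ 2 := by
  rw [norm_add_sq (𝕜 := ℂ), inner_I_mul_self_re hA h, norm_smul]
  simp

theorem norm_le_norm_add_I_smul {A : E →ₗ.[ℂ] E} (hA : IsSelfAdjoint A) {x y : E}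
    (h : (x, y) ∈ A.graph) (ε : ℝ) : ‖x‖ ≤ ‖x + (Complex.I * ε) • y‖ := by
  refine le_of_sq_le_sq ?_ (norm_nonneg _)
  rw [norm_add_I_smul_sq hA h]
  nlinarith [sq_nonneg (|ε| * ‖y‖)]

theorem abs_mul_norm_le_norm_add_I_smul {A : E →ₗ.[ℂ] E} (hA : IsSelfAdjoint A) {x y : E}
    (h : (x, y) ∈ A.graph) (ε : ℝ) : |ε| * ‖y‖ ≤ ‖x + (Complex.I * ε) • y‖ := by
  refine le_of_sq_le_sq ?_ (norm_nonneg _)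
  rw [norm_add_I_smul_sq hA h]
  nlinarith [sq_nonneg ‖x‖]

/-- `1 + iεA` is onto for a self-adjoint operator `A`. -/
theorem exists_add_I_smul_eq {A : E →ₗ.[ℂ] E} (hA : IsSelfAdjoint A) {ε : ℝ} (hε : ε ≠ 0)
    (ψ : E) : ∃ x y, (x, y) ∈ A.graph ∧ x + (Complex.I * ε) • y = ψ := by
  have hcl : _root_.IsClosed (A.graph : Set (E × E)) := hA.isClosed
  have : CompleteSpace A.graph := hcl.completeSpace_coe
  let T : A.graph →L[ℂ] E :=
    ((ContinuousLinearMap.fst ℂ E E) + (Complex.I * ε) • (ContinuousLinearMap.snd ℂ E E)).comp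
      A.graph.subtypeL
  have hT : ∀ z : A.graph, T z = z.1.1 + (Complex.I * ε) • z.1.2 := fun z => rfl
  have hε' : 0 < |ε| := abs_pos.2 hε
  -- Being bounded below on the complete space `A.graph`, `T` has closed range; it remains to see
  -- that the range is dense.
  have hanti : AntilipschitzWith (1 + |ε|⁻¹).toNNReal T := by
    refine T.antilipschitz_of_bound fun z => ?_
    rw [Real.coe_toNNReal _ (by positivity), hT]
    have h1 := norm_le_norm_add_I_smul hA z.2 ε
    have h2 := abs_mul_norm_le_norm_add_I_smul hA z.2 ε
    have h3 : ‖z.1.2‖ ≤ |ε|⁻¹ * ‖z.1.1 + (Complex.I * ε) • z.1.2‖ := by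
      rw [← div_eq_inv_mul, le_div_iff₀ hε', mul_comm]; exact h2
    have h0 := norm_nonneg (z.1.1 + (Complex.I * ε) • z.1.2)
    have h4 : 0 ≤ |ε|⁻¹ * ‖z.1.1 + (Complex.I * ε) • z.1.2‖ := by positivity
    change max ‖z.1.1‖ ‖z.1.2‖ ≤ _
    refine max_le ?_ ?_ <;> nlinarith
  have hclosed : _root_.IsClosed (LinearMap.range T.toLinearMap : Set E) := by
    rw [LinearMap.coe_range]
    exact hanti.isClosed_range T.uniformContinuous
  have hperp : (LinearMap.range T.toLinearMap)ᗮ = ⊥ := by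
    rw [Submodule.eq_bot_iff]
    intro z hz
    have hmem : (z, (Complex.I * ε)⁻¹ • z) ∈ A.graph := by
      rw [← adjoint_graph_eq_of_isSelfAdjoint hA, Submodule.mem_adjoint_iff]
      intro x y hxy
      have h1 : inner ℂ (x + (Complex.I * ε) • y) z = 0 :=
        (Submodule.mem_orthogonal _ _).1 hz _ ⟨⟨(x, y), hxy⟩, rfl⟩
      rw [inner_add_left, inner_smul_left] at h1
      simp only [map_mul, Complex.conj_I, Complex.conj_ofReal] at h1
      have hε2 : (ε : ℂ) ≠ 0 := by exact_mod_cast hε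
      rw [inner_smul_right]
      field_simp
      linear_combination -h1
    -- Here `Az = (iε)⁻¹z`, a nonreal eigenvalue. In the norm identity at `-ε` the left side is
    -- zero, which forces `z = 0`.
    have h2 := norm_add_I_smul_sq hA hmem (-ε)
    have hε2 : (Complex.I * ε) ≠ 0 := mul_ne_zero Complex.I_ne_zero (by exact_mod_cast hε)
    have h3 : z + (Complex.I * (-ε : ℝ)) • (Complex.I * ε)⁻¹ • z = 0 := by
      rw [smul_smul]
      push_cast
      rw [mul_neg, neg_mul, mul_inv_cancel₀ hε2]
      simp
    rw [h3] at h2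
    have : ‖z‖ ^ 2 = 0 := by
      nlinarith [sq_nonneg ‖z‖, sq_nonneg (|-ε| * ‖(Complex.I * ε)⁻¹ • z‖), norm_zero (E := E)]
    simpa using this
  have htop : LinearMap.range T.toLinearMap = ⊤ := by
    rw [← hclosed.submodule_topologicalClosure_eq, Submodule.topologicalClosure_eq_top_iff]
    exact hperp
  obtain ⟨z, hz⟩ := LinearMap.range_eq_top.1 htop ψ
  exact ⟨z.1.1, z.1.2, z.2, hz⟩

/-- The solution of `x + iεAx = ψ` tends to `ψ` as `ε → 0`. -/
theorem exists_pos_forall_norm_sub_lt {A : E →ₗ.[ℂ] E} (hA : IsSelfAdjoint A) (ψ : E) {δ : ℝ}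
    (hδ : 0 < δ) : ∃ ε₀ > 0, ∀ ε : ℝ, |ε| < ε₀ → ∀ x y, (x, y) ∈ A.graph →
      x + (Complex.I * ε) • y = ψ → ‖x - ψ‖ < δ := by
  obtain ⟨χ, hχ, hd⟩ := Metric.dense_iff.1 hA.dense_domain ψ (δ / 3) (by positivity)
  have hg := A.mem_graph ⟨χ, hd⟩
  set χ' := A ⟨χ, hd⟩
  simp only at hg
  -- The inverse of `1 + iεA` is a contraction, so `ψ` may be replaced by `χ` in the domain. The
  -- error is twice `‖ψ - χ‖` plus `‖iεAχ‖`, each below or at most `δ/3`; the `1 +` avoids division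
  -- by zero.
  refine ⟨δ / 3 / (1 + ‖χ'‖), by positivity, fun ε hε x y hxy h => ?_⟩
  have h1 : (x - χ, y - χ') ∈ A.graph := A.graph.sub_mem hxy hg
  have h2 := norm_le_norm_add_I_smul hA h1 ε
  have h3 : x - χ + (Complex.I * ε) • (y - χ') = (ψ - χ) - (Complex.I * ε) • χ' := by
    rw [← h, smul_sub]; abel
  have h4 : ‖(Complex.I * ε) • χ'‖ ≤ δ / 3 := by
    rw [norm_smul]
    simp only [Complex.norm_mul, Complex.norm_I, one_mul, Complex.norm_real, Real.norm_eq_abs]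
    have : |ε| * (1 + ‖χ'‖) < δ / 3 := (lt_div_iff₀ (by positivity)).1 hε
    nlinarith [abs_nonneg ε]
  have h5 : ‖ψ - χ‖ < δ / 3 := by rwa [Metric.mem_ball, dist_comm, dist_eq_norm] at hχ
  calc ‖x - ψ‖ = ‖(x - χ) - (ψ - χ)‖ := by congr 1; abel
    _ ≤ ‖x - χ‖ + ‖ψ - χ‖ := norm_sub_le _ _
    _ ≤ (‖ψ - χ‖ + ‖(Complex.I * ε) • χ'‖) + ‖ψ - χ‖ := by
        gcongr
        rw [h3] at h2
        exact h2.trans (norm_sub_le _ _)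
    _ < δ := by linarith

/-- The virial theorem. -/
theorem inner_commutator_eq_zero {A : E →ₗ.[ℂ] E} (hA : IsSelfAdjoint A) {H C : E →L[ℂ] E}
    (hH : IsSelfAdjoint H) (hC : IsCommutator A H C) {μ : ℝ} {ψ : E}
    (hψ : H ψ = (μ : ℂ) • ψ) : inner ℂ ψ (C ψ) = 0 := by
  rw [isCommutator_iff_graph] at hC
  have hsymm : ∀ u v, inner ℂ (H u) v = inner ℂ u (H v) := fun u v => by
    conv_lhs => rw [← hH.adjoint_eq]
    exact ContinuousLinearMap.adjoint_inner_left H v u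
  -- An eigenvector need not lie in the domain of `A`, so it is regularised to `x = (1 + iεA)⁻¹ψ`
  -- and `y = (1 - iεA)⁻¹ψ`. With opposite signs the two resolvents are adjoint to each other, so
  -- `⟨y, ψ⟩ = ⟨ψ, x⟩` and the commutator form vanishes exactly for each `ε`.
  have key : ∀ ε : ℝ, ε ≠ 0 → ∀ x x' y y', (x, x') ∈ A.graph → (y, y') ∈ A.graph →
      x + (Complex.I * ε) • x' = ψ → y + (Complex.I * (-ε : ℝ)) • y' = ψ →
      inner ℂ y (C x) = 0 := by
    intro ε hε x x' y y' hx hy hxψ hyψ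
    have hε' : (ε : ℂ) ≠ 0 := by exact_mod_cast hε
    have e1 : x' = (Complex.I * ε)⁻¹ • (ψ - x) := by
      rw [← hxψ, add_sub_cancel_left, inv_smul_smul₀ (mul_ne_zero Complex.I_ne_zero hε')]
    have e2 : y' = -((Complex.I * ε)⁻¹ • (ψ - y)) := by
      rw [← hyψ, add_sub_cancel_left]
      push_cast
      rw [mul_neg, neg_smul, smul_neg, neg_neg,
        inv_smul_smul₀ (mul_ne_zero Complex.I_ne_zero hε')]
    have e3 : inner ℂ y ψ = inner ℂ ψ x := by
      have := inner_graph_symm hA hy hx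
      conv_lhs => rw [← hxψ, inner_add_right, inner_smul_right, ← this]
      conv_rhs => rw [← hyψ, inner_add_left, inner_smul_left]
      simp
    rw [hC y y' x x' hy hx, e1, e2, map_smul, map_sub, hψ, inner_smul_right, inner_sub_right,
      inner_smul_right, inner_neg_left, inner_smul_left, inner_sub_left, ← hsymm ψ x, hψ,
      inner_smul_left, e3]
    simp only [map_inv₀, map_mul, Complex.conj_I, Complex.conj_ofReal]
    field_simp
    ring
  refine norm_le_zero_iff.1 (le_of_forall_pos_le_add fun δ hδ => ?_)
  obtain ⟨δ', hδ', hδ''⟩ : ∃ δ' > 0, δ' * (‖C‖ * (‖ψ‖ + δ')) + ‖ψ‖ * ‖C‖ * δ' < δ := by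
    have hc : Tendsto (fun t : ℝ => t * (‖C‖ * (‖ψ‖ + t)) + ‖ψ‖ * ‖C‖ * t) (𝓝[>] 0) (𝓝 0) := by
      have : Continuous fun t : ℝ => t * (‖C‖ * (‖ψ‖ + t)) + ‖ψ‖ * ‖C‖ * t := by fun_prop
      simpa using (this.tendsto 0).mono_left nhdsWithin_le_nhds
    obtain ⟨t, h1, h2⟩ := ((hc.eventually (gt_mem_nhds hδ)).and self_mem_nhdsWithin).exists
    exact ⟨t, h2, h1⟩
  obtain ⟨ε₀, hε₀, h⟩ := exists_pos_forall_norm_sub_lt hA ψ hδ'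
  have hpos : 0 < ε₀ / 2 := by positivity
  obtain ⟨x, x', hx, hxψ⟩ := exists_add_I_smul_eq hA hpos.ne' ψ
  obtain ⟨y, y', hy, hyψ⟩ := exists_add_I_smul_eq hA (neg_ne_zero.2 hpos.ne') ψ
  have hlt : |ε₀ / 2| < ε₀ := by rw [abs_of_pos hpos]; linarith
  have h1 := h (ε₀ / 2) hlt x x' hx hxψ
  have h2 := h (-(ε₀ / 2)) (by rwa [abs_neg]) y y' hy hyψ
  have h0 := key _ hpos.ne' x x' y y' hx hy hxψ hyψ
  have hsplit : inner ℂ ψ (C ψ) = -inner ℂ (y - ψ) (C x) - inner ℂ ψ (C (x - ψ)) := by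
    rw [map_sub, inner_sub_left, inner_sub_right, h0]; ring
  have hx' : ‖x‖ ≤ ‖ψ‖ + δ' := by
    calc ‖x‖ = ‖ψ + (x - ψ)‖ := by congr 1; abel
      _ ≤ ‖ψ‖ + ‖x - ψ‖ := norm_add_le _ _
      _ ≤ _ := by gcongr
  rw [hsplit, zero_add]
  calc ‖-inner ℂ (y - ψ) (C x) - inner ℂ ψ (C (x - ψ))‖
      ≤ ‖y - ψ‖ * ‖C x‖ + ‖ψ‖ * ‖C (x - ψ)‖ := by
        refine (norm_sub_le _ _).trans (add_le_add ?_ (norm_inner_le_norm _ _))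
        rw [norm_neg]
        exact norm_inner_le_norm _ _
    _ ≤ δ' * (‖C‖ * (‖ψ‖ + δ')) + ‖ψ‖ * (‖C‖ * δ') := by
        gcongr
        · exact (C.le_opNorm x).trans (by gcongr)
        · exact (C.le_opNorm _).trans (by gcongr)
    _ ≤ δ := by linarith

end Graphs

/-! ### Functions of self-adjoint operators and compact perturbations -/

section Compact

variable {E : Type*} [NormedAddCommGroup E] [InnerProductSpace ℂ E]

/-- Compact operators form an ideal, so differences of powers are compact by telescoping. -/
theorem isCompactOperator_aeval_add_sub (H V : E →L[ℂ] E) (hV : IsCompactOperator V)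
    (p : Polynomial ℝ) :
    IsCompactOperator (Polynomial.aeval (H + V) p - Polynomial.aeval H p : E →L[ℂ] E) := by
  have hpow : ∀ n : ℕ, IsCompactOperator ((H + V) ^ n - H ^ n : E →L[ℂ] E) := by
    intro n
    induction n with
    | zero => simpa using isCompactOperator_zero
    | succ n ih =>
      have e : (H + V) ^ (n + 1) - H ^ (n + 1)
          = ((H + V) ^ n - H ^ n) * (H + V) + H ^ n * V := by
        rw [pow_succ, pow_succ]; noncomm_ring
      rw [e]
      exact (ih.comp_clm (H + V)).add (hV.clm_comp (H ^ n))
  induction p using Polynomial.induction_on' with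
  | add p q hp hq =>
    rw [map_add, map_add, add_sub_add_comm]
    exact hp.add hq
  | monomial n a =>
    rw [Polynomial.aeval_monomial, Polynomial.aeval_monomial, ← mul_sub,
      ← Algebra.smul_def]
    exact (hpow n).smul a

theorem aeval_apply_eigenvector {H : E →L[ℂ] E} {μ : ℝ} {ψ : E} (hψ : H ψ = (μ : ℂ) • ψ)
    (p : Polynomial ℝ) : (Polynomial.aeval H p) ψ = ((p.eval μ : ℝ) : ℂ) • ψ := by
  have hpow : ∀ n : ℕ, (H ^ n) ψ = ((μ : ℂ) ^ n) • ψ := by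
    intro n
    induction n with
    | zero => simp
    | succ n ih =>
      rw [pow_succ, mul_apply_eq_comp, hψ, map_smul, ih, smul_smul, pow_succ, mul_comm]
  induction p using Polynomial.induction_on' with
  | add p q hp hq => simp [hp, hq, add_smul]
  | monomial n a =>
    rw [Polynomial.aeval_monomial, ← Algebra.smul_def, Polynomial.eval_monomial]
    change a • (H ^ n) ψ = _
    rw [hpow]
    push_cast
    rw [mul_smul, Complex.coe_smul]

/-- Along a subsequence `K e_n` converges to some `y`, and `⟨e_n, y⟩ → 0` by Bessel, so the diagonal
elements of `K` have arbitrarily small values. Below, an infinite family of eigenvectors would make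
them all equal to `-1`. -/
theorem exists_norm_inner_lt_one {K : E →L[ℂ] E} (hK : IsCompactOperator K) {e : ℕ → E}
    (he : Orthonormal ℂ e) : ∃ n, ‖inner ℂ (e n) (K (e n))‖ < 1 := by
  obtain ⟨S, hS, hsub⟩ := hK.image_closedBall_subset_compact (f := (K : E →ₗ[ℂ] E)) 1
  have hmem : ∀ n, K (e n) ∈ S := fun n =>
    hsub ⟨e n, by simp [he.1 n], rfl⟩
  obtain ⟨y, -, φ, hφ, hy⟩ := hS.tendsto_subseq hmem
  have h1 : Tendsto (fun n => ‖inner ℂ (e n) y‖ ^ 2) atTop (𝓝 0) :=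
    (he.inner_products_summable y).tendsto_atTop_zero
  have h2 : Tendsto (fun n => ‖inner ℂ (e (φ n)) y‖) atTop (𝓝 0) := by
    have := (h1.comp hφ.tendsto_atTop).sqrt
    simpa [Function.comp_def] using this
  have h3 : Tendsto (fun n => ‖inner ℂ (e (φ n)) y‖ + ‖K (e (φ n)) - y‖) atTop (𝓝 0) := by
    simpa using h2.add (tendsto_iff_norm_sub_tendsto_zero.1 hy)
  obtain ⟨n, hn⟩ := (h3.eventually (gt_mem_nhds one_pos)).exists
  refine ⟨φ n, lt_of_le_of_lt ?_ hn⟩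
  have e1 : K (e (φ n)) = y + (K (e (φ n)) - y) := by abel
  conv_lhs => rw [e1, inner_add_right]
  refine (norm_add_le _ _).trans ?_
  gcongr
  refine (norm_inner_le_norm _ _).trans ?_
  rw [he.1, one_mul]

variable [CompleteSpace E]

/-- `Z` is obtained from `ζ` and `H` as a limit of polynomials, uniformly on `[-R, R]`. -/
def IsFunctionOf (Z H : E →L[ℂ] E) (ζ : ℝ → ℝ) (R : ℝ) : Prop :=
  ∀ p : Polynomial ℝ, ∀ δ : ℝ, 0 ≤ δ → (∀ x ∈ Icc (-R) R, |p.eval x - ζ x| ≤ δ) →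
    ‖Polynomial.aeval H p - Z‖ ≤ δ

theorem isFunctionOf_cfc {H : E →L[ℂ] E} (hH : IsSelfAdjoint H) {ζ : ℝ → ℝ} (hζ : Continuous ζ)
    {R : ℝ} (hR : ‖H‖ ≤ R) : IsFunctionOf (cfc ζ H) H ζ R := by
  intro p δ hδ h
  rw [← cfc_polynomial p H hH, ← cfc_sub _ _ H p.continuous.continuousOn hζ.continuousOn]
  refine norm_cfc_le hδ fun x hx => ?_
  have h1 : ‖x‖ ≤ R := by
    -- Bounding the spectrum by the norm requires `‖1‖ = 1`, which fails on the zero space; there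
    -- the spectrum is empty.
    rcases subsingleton_or_nontrivial E with hE | hE
    · have : spectrum ℝ H = ∅ := by
        have : Subsingleton (E →L[ℂ] E) := ⟨fun a b => by ext x; exact Subsingleton.elim _ _⟩
        exact spectrum.of_subsingleton H
      rw [this] at hx; exact hx.elim
    · exact (spectrum.norm_le_norm_of_mem hx).trans hR
  exact h x (abs_le.1 h1)

/-- The same Weierstrass polynomials approximate `Z` and `Z'` in norm, and a norm limit of compact
operators is compact. `IsFunctionOf` lets `Z` be given concretely, as multiplications by `ζ(λ_j)`,
without first identifying it with `cfc ζ H`. -/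
theorem IsFunctionOf.isCompactOperator_sub {H V Z Z' : E →L[ℂ] E} (hV : IsCompactOperator V)
    {ζ : ℝ → ℝ} (hζ : Continuous ζ) {R : ℝ} (hZ : IsFunctionOf Z H ζ R)
    (hZ' : IsFunctionOf Z' (H + V) ζ R) : IsCompactOperator (Z - Z' : E →L[ℂ] E) := by
  have hex : ∀ n : ℕ, ∃ p : Polynomial ℝ, ∀ x ∈ Icc (-R) R,
      |p.eval x - ζ x| < 1 / ((n : ℝ) + 1) := fun n =>
    exists_polynomial_near_of_continuousOn _ _ ζ hζ.continuousOn _ (by positivity)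
  choose p hp using hex
  have h1 : ∀ n, ‖Polynomial.aeval H (p n) - Z‖ ≤ 1 / ((n : ℝ) + 1) := fun n =>
    hZ (p n) _ (by positivity) fun x hx => (hp n x hx).le
  have h2 : ∀ n, ‖Polynomial.aeval (H + V) (p n) - Z'‖ ≤ 1 / ((n : ℝ) + 1) := fun n =>
    hZ' (p n) _ (by positivity) fun x hx => (hp n x hx).le
  have t1 : Tendsto (fun n => Polynomial.aeval H (p n)) atTop (𝓝 Z) :=
    tendsto_iff_norm_sub_tendsto_zero.2 (squeeze_zero (fun _ => norm_nonneg _) h1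
      tendsto_one_div_add_atTop_nhds_zero_nat)
  have t2 : Tendsto (fun n => Polynomial.aeval (H + V) (p n)) atTop (𝓝 Z') :=
    tendsto_iff_norm_sub_tendsto_zero.2 (squeeze_zero (fun _ => norm_nonneg _) h2
      tendsto_one_div_add_atTop_nhds_zero_nat)
  refine isCompactOperator_of_tendsto (t1.sub t2) (Eventually.of_forall fun n => ?_)
  have := (isCompactOperator_aeval_add_sub H V hV (p n)).neg
  rw [← neg_sub]
  exact this

theorem cfc_apply_eigenvector {H : E →L[ℂ] E} (hH : IsSelfAdjoint H) {f : ℝ → ℝ}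
    (hf : Continuous f) {μ : ℝ} {ψ : E} (hψ : H ψ = (μ : ℂ) • ψ) :
    (cfc f H) ψ = ((f μ : ℝ) : ℂ) • ψ := by
  -- The interval must contain `μ` too, since the polynomial approximation is also evaluated there.
  set R := max ‖H‖ |μ| with hR
  have hfun := isFunctionOf_cfc hH hf (le_max_left ‖H‖ |μ|)
  rw [← sub_eq_zero]
  refine norm_le_zero_iff.1 (le_of_forall_pos_le_add fun δ hδ => ?_)
  obtain ⟨p, hp⟩ := exists_polynomial_near_of_continuousOn (-R) R f hf.continuousOn
    (δ / (2 * (1 + ‖ψ‖))) (by positivity)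
  have h1 := hfun p (δ / (2 * (1 + ‖ψ‖))) (by positivity) fun x hx => (hp x hx).le
  have h2 := hp μ (abs_le.1 (le_max_right _ _))
  have e : (cfc f H) ψ - ((f μ : ℝ) : ℂ) • ψ = ((p.eval μ - f μ : ℝ) : ℂ) • ψ
      - (Polynomial.aeval H p - cfc f H) ψ := by
    rw [sub_apply, aeval_apply_eigenvector hψ]
    push_cast
    rw [sub_smul]; abel
  rw [e, zero_add]
  calc _ ≤ ‖((p.eval μ - f μ : ℝ) : ℂ) • ψ‖ + ‖(Polynomial.aeval H p - cfc f H) ψ‖ :=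
        norm_sub_le _ _
    _ ≤ (δ / (2 * (1 + ‖ψ‖))) * ‖ψ‖ + (δ / (2 * (1 + ‖ψ‖))) * ‖ψ‖ := by
        refine add_le_add ?_ ((ContinuousLinearMap.le_opNorm _ _).trans (by gcongr))
        rw [norm_smul, Complex.norm_real]
        exact mul_le_mul_of_nonneg_right h2.le (norm_nonneg _)
    _ = δ * (‖ψ‖ / (1 + ‖ψ‖)) := by field_simp; ring
    _ ≤ δ * 1 := by
        gcongr
        rw [div_le_one (by positivity)]
        linarith
    _ = δ := mul_one δ

theorem spectralProj_apply_eigenvector {H : E →L[ℂ] E} (hH : IsSelfAdjoint H) {s : Set ℝ}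
    {μ : ℝ} (hμ : μ ∈ s) {ψ : E} (hψ : H ψ = (μ : ℂ) • ψ) : spectralProj H s ψ = ψ := by
  refine Submodule.starProjection_eq_self_iff.2 ?_
  rw [spectralSubspace, Submodule.mem_iInf]
  intro f
  change (cfc f.1 H) ψ = 0
  rw [cfc_apply_eigenvector hH f.2.1 hψ, f.2.2 μ hμ]
  simp

/-- The function `ζ - 1` vanishes on `s`, hence is one of those whose kernels cut out
`spectralSubspace H s`. -/
theorem cfc_mul_spectralProj {H : E →L[ℂ] E} (hH : IsSelfAdjoint H) {s : Set ℝ} {ζ : ℝ → ℝ}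
    (hζ : Continuous ζ) (hs : ∀ x ∈ s, ζ x = 1) :
    cfc ζ H * spectralProj H s = spectralProj H s := by
  ext ψ
  have hmem : spectralProj H s ψ ∈ spectralSubspace H s := Submodule.starProjection_apply_mem _ _
  rw [spectralSubspace, Submodule.mem_iInf] at hmem
  have h := hmem ⟨fun x => ζ x - 1, hζ.sub continuous_const, fun x hx => by simp [hs x hx]⟩
  change (cfc (fun x => ζ x - 1) H) (spectralProj H s ψ) = 0 at h
  rw [cfc_sub _ _ H hζ.continuousOn continuousOn_const, cfc_const_one ℝ H hH, sub_apply,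
    sub_eq_zero] at h
  exact h

/-- The Mourre estimate for a commutator that is a compact perturbation of `ζ(H)`. -/
theorem exists_compact_mourre {H Z B : E →L[ℂ] E} (hH : IsSelfAdjoint H) {s : Set ℝ}
    {ζ : ℝ → ℝ} (hζ : Continuous ζ) (hs : ∀ x ∈ s, ζ x = 1)
    (hZ : IsCompactOperator (Z - cfc ζ H : E →L[ℂ] E)) (hB : IsCompactOperator B) :
    ∃ K : E →L[ℂ] E, IsCompactOperator K ∧
      spectralProj H s * (Z + B) * spectralProj H s = spectralProj H s + K := by
  refine ⟨spectralProj H s * (Z - cfc ζ H + B) * spectralProj H s, ?_, ?_⟩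
  · exact ((hZ.add hB).clm_comp (spectralProj H s)).comp_clm (spectralProj H s)
  · have hP : spectralProj H s * spectralProj H s = spectralProj H s :=
      Submodule.isIdempotentElem_starProjection _
    have h := cfc_mul_spectralProj hH hζ hs
    calc _ = spectralProj H s * (cfc ζ H * spectralProj H s)
          + spectralProj H s * (Z - cfc ζ H + B) * spectralProj H s := by noncomm_ring
      _ = _ := by rw [h, hP]

/-- A Mourre estimate and the virial theorem bound the number of eigenvalues. -/
theorem finite_eigenvalues_of_mourre {H C K : E →L[ℂ] E} (hH : IsSelfAdjoint H) {s : Set ℝ}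
    (hK : IsCompactOperator K)
    (hM : spectralProj H s * C * spectralProj H s = spectralProj H s + K)
    (hv : ∀ (μ : ℝ) (ψ : E), H ψ = (μ : ℂ) • ψ → inner ℂ ψ (C ψ) = 0) :
    {μ : ℝ | μ ∈ s ∧ Module.End.HasEigenvalue H.toLinearMap (μ : ℂ)}.Finite ∧
      ∀ μ ∈ s, FiniteDimensional ℂ (Module.End.eigenspace H.toLinearMap ((μ : ℝ) : ℂ)) := by
  have hPsa : ∀ u v, inner ℂ (spectralProj H s u) v = inner ℂ u (spectralProj H s v) := fun u v =>
    Submodule.inner_starProjection_left_eq_right _ u v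
  -- The spectral projection fixes `ψ`, and the virial theorem removes the left side of `hM`.
  have key : ∀ μ ∈ s, ∀ ψ : E, H ψ = (μ : ℂ) • ψ → inner ℂ ψ (K ψ) = -inner ℂ ψ ψ := by
    intro μ hμ ψ hψ
    have hP := spectralProj_apply_eigenvector hH hμ hψ
    have h1 := congrArg (fun T : E →L[ℂ] E => inner ℂ ψ (T ψ)) hM
    simp only [mul_apply_eq_comp, add_apply, hP, inner_add_right] at h1
    rw [← hPsa, hP, hv μ ψ hψ] at h1
    linear_combination -h1
  have heig : ∀ (μ : ℝ) (ψ : E), ψ ∈ Module.End.eigenspace H.toLinearMap (μ : ℂ) →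
      H ψ = (μ : ℂ) • ψ := fun μ ψ h => Module.End.mem_eigenspace_iff.1 h
  constructor
  · by_contra hinf
    have hsymm : (H : E →ₗ[ℂ] E).IsSymmetric :=
      ContinuousLinearMap.isSelfAdjoint_iff_isSymmetric.1 hH
    set ν := Set.Infinite.natEmbedding _ hinf
    have hex : ∀ n, ∃ ψ : E, H ψ = (((ν n : ℝ) : ℂ)) • ψ ∧ ‖ψ‖ = 1 := by
      intro n
      obtain ⟨ψ, hψ⟩ := (ν n).2.2.exists_hasEigenvector
      have h0 : ‖ψ‖ ≠ 0 := norm_ne_zero_iff.2 hψ.2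
      refine ⟨((‖ψ‖⁻¹ : ℝ) : ℂ) • ψ, ?_, ?_⟩
      · rw [map_smul, heig _ _ hψ.1, smul_comm]
      · rw [norm_smul, Complex.norm_real, norm_inv, norm_norm, inv_mul_cancel₀ h0]
    choose e he1 he2 using hex
    have horth : Orthonormal ℂ e := by
      refine ⟨he2, fun m n hmn => ?_⟩
      have hne : (((ν m : ℝ)) : ℂ) ≠ ((ν n : ℝ) : ℂ) := fun h =>
        hmn (ν.injective (Subtype.ext (Complex.ofReal_injective h)))
      exact hsymm.orthogonalFamily_eigenspaces hne
        ⟨e m, Module.End.mem_eigenspace_iff.2 (he1 m)⟩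
        ⟨e n, Module.End.mem_eigenspace_iff.2 (he1 n)⟩
    obtain ⟨n, hn⟩ := exists_norm_inner_lt_one hK horth
    rw [key _ (ν n).2.1 _ (he1 n), norm_neg, inner_self_eq_norm_sq_to_K, he2] at hn
    simp at hn
  · intro μ hμ
    set M := Module.End.eigenspace H.toLinearMap ((μ : ℝ) : ℂ)
    have hMc : _root_.IsClosed (M : Set E) := by
      have : (M : Set E) = {ψ | H ψ = (μ : ℂ) • ψ} := by
        ext ψ; exact Module.End.mem_eigenspace_iff
      rw [this]
      exact isClosed_eq H.continuous (continuous_const_smul _)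
    have : CompleteSpace M := hMc.completeSpace_coe
    let T : M →L[ℂ] M := M.orthogonalProjectionOnto.comp (K.comp M.subtypeL)
    have hT : IsCompactOperator T :=
      (hK.comp_clm M.subtypeL).clm_comp M.orthogonalProjectionOnto
    -- The compression `T` of `K` to the eigenspace has quadratic form `-‖x‖²`, so `T = -1` by
    -- polarization. Thus the identity is compact and the eigenspace is finite-dimensional.
    have hT1 : T + 1 = 0 := by
      have := (inner_map_self_eq_zero (T + 1 : M →L[ℂ] M).toLinearMap).1 (fun x => by
        have h := key μ hμ x (heig μ x x.2)
        change inner ℂ (T x + x) x = 0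
        have hTx : inner ℂ (T x) x = (starRingEnd ℂ) (inner ℂ (x : E) (K x)) := by
          rw [inner_conj_symm]
          exact Submodule.inner_orthogonalProjectionOnto_eq_of_mem_right x (K x)
        rw [inner_add_left, hTx, h, map_neg, inner_conj_symm, Submodule.coe_inner]
        ring)
      ext x
      simpa using congrArg Subtype.val (LinearMap.congr_fun this x)
    refine FiniteDimensional.of_isCompactOperator_id (𝕜 := ℂ) ?_
    have h2 : (id : M → M) = -T := by
      funext x
      have := congrArg (fun S : M →L[ℂ] M => S x) hT1
      simp only [add_apply, one_apply_eq_self] at this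
      exact (neg_eq_of_add_eq_zero_right this).symm
    rw [h2]
    exact hT.neg

end Compact

/-! ### First order operators in a Fourier basis -/

section FourierBasis

variable {E : Type*} [NormedAddCommGroup E] [InnerProductSpace ℂ E]

theorem hilbertBasis_ext (b : HilbertBasis ℤ ℂ E) {x y : E}
    (h : ∀ k, inner ℂ (b k) x = inner ℂ (b k) y) : x = y := by
  apply b.repr.injective
  ext k
  rw [b.repr_apply_apply, b.repr_apply_apply, h]

theorem hilbertBasis_clm_ext (b : HilbertBasis ℤ ℂ E) {S T : E →L[ℂ] E}
    (h : ∀ k l, inner ℂ (b k) (S (b l)) = inner ℂ (b k) (T (b l))) : S = T := by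
  refine ContinuousLinearMap.ext_on (s := range b)
    (Submodule.dense_iff_topologicalClosure_eq_top.2 b.dense_span) ?_
  rintro _ ⟨l, rfl⟩
  exact hilbertBasis_ext b fun k => h k l

theorem inner_basis (b : HilbertBasis ℤ ℂ E) (k l : ℤ) :
    inner ℂ (b k) (b l) = if k = l then 1 else 0 :=
  orthonormal_iff_ite.1 b.orthonormal k l

theorem diagonal_memℓp (b : HilbertBasis ℤ ℂ E) {c : ℤ → ℂ} (hc : ∀ k, ‖c k‖ ≤ 1) (u : E) :
    Memℓp (fun k => c k * b.repr u k) 2 :=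
  (lp.memℓp (b.repr u)).mono' fun k => by
    rw [norm_mul]; exact mul_le_of_le_one_left (norm_nonneg _) (hc k)

/-- The diagonal operator with entries `c k`, `‖c k‖ ≤ 1`. -/
noncomputable def diagOp (b : HilbertBasis ℤ ℂ E) (c : ℤ → ℂ) (hc : ∀ k, ‖c k‖ ≤ 1) : E →L[ℂ] E :=
  LinearMap.mkContinuous
    { toFun := fun u => b.repr.symm ⟨fun k => c k * b.repr u k, diagonal_memℓp b hc u⟩
      map_add' := fun u v => by
        rw [← map_add]; congr 1; ext k; simp [mul_add]; rfl
      map_smul' := fun a u => by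
        rw [← map_smul]; congr 1; ext k; simp [mul_left_comm] }
    1 (fun u => by
      rw [one_mul]
      refine (b.repr.symm.norm_map _).le.trans ?_
      rw [← b.repr.norm_map u]
      refine lp.norm_mono (x := (⟨fun k => c k * b.repr u k, diagonal_memℓp b hc u⟩ :
        lp (fun _ : ℤ => ℂ) 2)) (y := b.repr u) (by norm_num) fun k => ?_
      change ‖c k * b.repr u k‖ ≤ _
      rw [norm_mul]; exact mul_le_of_le_one_left (norm_nonneg _) (hc k))

theorem norm_diagOp_le (b : HilbertBasis ℤ ℂ E) {c : ℤ → ℂ} (hc : ∀ k, ‖c k‖ ≤ 1) :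
    ‖diagOp b c hc‖ ≤ 1 :=
  LinearMap.mkContinuous_norm_le _ zero_le_one _

theorem inner_diagOp (b : HilbertBasis ℤ ℂ E) {c : ℤ → ℂ} (hc : ∀ k, ‖c k‖ ≤ 1) (k : ℤ) (u : E) :
    inner ℂ (b k) (diagOp b c hc u) = c k * inner ℂ (b k) u := by
  rw [← b.repr_apply_apply, ← b.repr_apply_apply]
  change b.repr (b.repr.symm _) k = _
  rw [LinearIsometryEquiv.apply_symm_apply]

theorem diagOp_basis (b : HilbertBasis ℤ ℂ E) {c : ℤ → ℂ} (hc : ∀ k, ‖c k‖ ≤ 1) (l : ℤ) :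
    diagOp b c hc (b l) = c l • b l :=
  hilbertBasis_ext b fun k => by
    rw [inner_diagOp, inner_smul_right, inner_basis]
    split_ifs with h
    · rw [h]
    · simp

/-- The entries `1 / (1 + iεk)` of the resolvent. -/
noncomputable def resolventCoeff (ε : ℝ) (k : ℤ) : ℂ := (1 + Complex.I * ε * k)⁻¹

theorem one_add_I_mul_ne_zero (ε : ℝ) (k : ℤ) : (1 + Complex.I * ε * k : ℂ) ≠ 0 := by
  intro h
  simpa using congrArg Complex.re h

theorem norm_resolventCoeff_le (ε : ℝ) (k : ℤ) : ‖resolventCoeff ε k‖ ≤ 1 := by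
  rw [resolventCoeff, norm_inv]
  refine inv_le_one_of_one_le₀ ?_
  have := Complex.abs_re_le_norm (1 + Complex.I * ε * k)
  simpa using this

/-- The resolvent `(1 + iεD)⁻¹` of the diagonal operator `D` with entries `k`. -/
noncomputable def resolvent (b : HilbertBasis ℤ ℂ E) (ε : ℝ) : E →L[ℂ] E :=
  diagOp b (resolventCoeff ε) (norm_resolventCoeff_le ε)

/-- Operators `R n` with `‖R n‖ ≤ 1` that tend strongly to `1` on a basis do so everywhere. -/
theorem tendsto_apply_of_basis (b : HilbertBasis ℤ ℂ E) {R : ℕ → E →L[ℂ] E}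
    (hR : ∀ n, ‖R n‖ ≤ 1) (hb : ∀ k, Tendsto (fun n => R n (b k)) atTop (𝓝 (b k)))
    {x : ℕ → E} {u : E} (hx : Tendsto x atTop (𝓝 u)) :
    Tendsto (fun n => R n (x n)) atTop (𝓝 u) := by
  have hspan : ∀ v ∈ Submodule.span ℂ (range b), Tendsto (fun n => R n v) atTop (𝓝 v) := by
    intro v hv
    induction hv using Submodule.span_induction with
    | mem v hv => obtain ⟨k, rfl⟩ := hv; exact hb k
    | zero => simp
    | add v w _ _ hv hw => simpa using hv.add hw
    | smul a v _ hv => simpa using hv.const_smul a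
  have hd : Dense (Submodule.span ℂ (range b) : Set E) :=
    Submodule.dense_iff_topologicalClosure_eq_top.2 b.dense_span
  rw [Metric.tendsto_atTop]
  intro δ hδ
  obtain ⟨v, hv, hvs⟩ := Metric.dense_iff.1 hd u (δ / 4) (by positivity)
  obtain ⟨n₁, h₁⟩ := Metric.tendsto_atTop.1 (hspan v hvs) (δ / 4) (by positivity)
  obtain ⟨n₂, h₂⟩ := Metric.tendsto_atTop.1 hx (δ / 4) (by positivity)
  refine ⟨max n₁ n₂, fun n hn => ?_⟩
  have e1 := h₁ n ((le_max_left _ _).trans hn)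
  have e2 := h₂ n ((le_max_right _ _).trans hn)
  rw [Metric.mem_ball, dist_eq_norm] at hv
  rw [dist_eq_norm] at e1 e2 ⊢
  have e3 : R n (x n) - u = R n (x n - u) + R n (u - v) + (R n v - v) + (v - u) := by
    simp only [map_sub]; abel
  have hle : ∀ w, ‖R n w‖ ≤ ‖w‖ := fun w =>
    ((R n).le_of_opNorm_le (hR n) w).trans_eq (one_mul _)
  rw [e3]
  calc _ ≤ ‖R n (x n - u)‖ + ‖R n (u - v)‖ + ‖R n v - v‖ + ‖v - u‖ :=
        (norm_add_le _ _).trans (by gcongr; exact norm_add₃_le)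
    _ ≤ ‖x n - u‖ + ‖v - u‖ + ‖R n v - v‖ + ‖v - u‖ := by
        gcongr
        · exact hle _
        · rw [norm_sub_rev v u]; exact hle _
    _ < δ := by linarith

theorem tendsto_resolvent (b : HilbertBasis ℤ ℂ E) {x : ℕ → E} {u : E}
    (hx : Tendsto x atTop (𝓝 u)) :
    Tendsto (fun n : ℕ => resolvent b (1 / ((n : ℝ) + 1)) (x n)) atTop (𝓝 u) := by
  refine tendsto_apply_of_basis b (fun n => norm_diagOp_le b _) (fun k => ?_) hx
  simp only [diagOp_basis]
  have h1 : Tendsto (fun n : ℕ => resolventCoeff (1 / ((n : ℝ) + 1)) k) atTop (𝓝 1) := by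
    have hc : ContinuousAt (fun ε : ℝ => resolventCoeff ε k) 0 := by
      refine ContinuousAt.inv₀ (by fun_prop) (one_add_I_mul_ne_zero 0 k)
    have := hc.tendsto.comp (tendsto_one_div_add_atTop_nhds_zero_nat (𝕜 := ℝ))
    simpa [Function.comp_def, resolventCoeff] using this
  simpa using h1.smul_const (b k)

/-- The operator `(i/2)(F d/dp + d/dp F)` on the basis vectors, `M` and `M'` being the
multiplications by `F` and `F'`. -/
noncomputable def basisAction (b : HilbertBasis ℤ ℂ E) (M M' : E →L[ℂ] E) (l : ℤ) : E :=
  -((l : ℂ) • M (b l)) + (Complex.I / 2) • M' (b l)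

/-- The graph of `(i/2)(F d/dp + d/dp F)` on the span of the basis vectors. -/
noncomputable def trigGraph (b : HilbertBasis ℤ ℂ E) (M M' : E →L[ℂ] E) : Submodule ℂ (E × E) :=
  Submodule.span ℂ (range fun l => (b l, basisAction b M M' l))

/-- `M'` is the derivative of `M`, in terms of matrix elements. -/
def IsMatrixDeriv (b : HilbertBasis ℤ ℂ E) (M M' : E →L[ℂ] E) : Prop :=
  ∀ k l : ℤ, inner ℂ (b k) (M' (b l)) = Complex.I * ((k : ℂ) - l) * inner ℂ (b k) (M (b l))

/-- The term with `M'` replaces the factor `l` by the mean `(k + l)/2`, symmetric in `k` and `l`;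
this makes the operator symmetric when `M` is. -/
theorem inner_basis_basisAction {b : HilbertBasis ℤ ℂ E} {M M' : E →L[ℂ] E}
    (h : IsMatrixDeriv b M M') (k l : ℤ) :
    inner ℂ (b k) (basisAction b M M' l) = -(((k : ℂ) + l) / 2) * inner ℂ (b k) (M (b l)) := by
  rw [basisAction, inner_add_right, inner_neg_right, inner_smul_right, inner_smul_right, h]
  linear_combination ((k : ℂ) - l) / 2 * inner ℂ (b k) (M (b l)) * Complex.I_mul_I

/-- In Fourier terms `v` is `i du/dp`, so `u` is any element of `H¹`. The partial sums of `u` and of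
`v` converge together, and `M`, `M'` are bounded. -/
theorem mem_closure_trigGraph {b : HilbertBasis ℤ ℂ E} {M M' : E →L[ℂ] E} {u v : E}
    (h : ∀ k : ℤ, inner ℂ (b k) v = -(k : ℂ) * inner ℂ (b k) u) :
    (u, M v + (Complex.I / 2) • M' u) ∈ (trigGraph b M M').topologicalClosure := by
  have hu := b.hasSum_repr u
  have hv := b.hasSum_repr v
  have h1 := (hv.mapL M).add ((hu.mapL M').const_smul (Complex.I / 2))
  have h2 := hu.prodMk h1
  refine mem_closure_of_tendsto h2 (Eventually.of_forall fun s => ?_)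
  refine Submodule.sum_mem _ fun k _ => ?_
  have e : (b.repr u k • b k, M (b.repr v k • b k) + (Complex.I / 2) • M' (b.repr u k • b k))
      = b.repr u k • (b k, basisAction b M M' k) := by
    rw [b.repr_apply_apply, b.repr_apply_apply, h, Prod.smul_mk, basisAction]
    simp only [map_smul, smul_add, smul_neg, smul_smul]
    rw [Prod.mk.injEq]
    refine ⟨rfl, ?_⟩
    rw [mul_comm (Complex.I / 2), ← neg_smul, neg_mul, mul_comm (k : ℂ)]
  change (b.repr u k • b k, M (b.repr v k • b k) + (Complex.I / 2) • M' (b.repr u k • b k)) ∈ _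
  rw [e]
  exact Submodule.smul_mem _ _ (Submodule.subset_span ⟨k, rfl⟩)

/-- With `r_k = (1 + iεk)⁻¹` one has `r_l - r_k = iε(k - l) r_k r_l`, and `i(k - l)` is the factor
from `M` to `M'`. The `ε` gained here offsets the `1/ε` lost in differentiating a mollified vector.
-/
theorem resolvent_mul_sub {b : HilbertBasis ℤ ℂ E} {M M' : E →L[ℂ] E} (h : IsMatrixDeriv b M M')
    (ε : ℝ) : M * resolvent b ε - resolvent b ε * M
      = (ε : ℂ) • (resolvent b ε * M' * resolvent b ε) := by
  refine hilbertBasis_clm_ext b fun k l => ?_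
  simp only [sub_apply, smul_apply, mul_apply_eq_comp, inner_sub_right,
    inner_smul_right, resolvent, diagOp_basis, inner_diagOp, map_smul, h k l]
  have hk := one_add_I_mul_ne_zero ε k
  have hl := one_add_I_mul_ne_zero ε l
  simp only [resolventCoeff]
  field_simp
  ring

/-- An identity between sesquilinear continuous expressions on the closure of the graph may be
checked on the basis vectors. -/
theorem closure_trigGraph_induction {b : HilbertBasis ℤ ℂ E} {M M' : E →L[ℂ] E}
    {Q : E × E → E × E → ℂ}
    (hadd : ∀ x y z, Q x (y + z) = Q x y + Q x z) (hsmul : ∀ (c : ℂ) x y, Q x (c • y) = c * Q x y)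
    (hadd' : ∀ x y z, Q (x + y) z = Q x z + Q y z)
    (hsmul' : ∀ (c : ℂ) x y, Q (c • x) y = (starRingEnd ℂ) c * Q x y)
    (hc : ∀ x, Continuous (Q x)) (hc' : ∀ y, Continuous fun x => Q x y)
    (h : ∀ k l, Q (b k, basisAction b M M' k) (b l, basisAction b M M' l) = 0)
    {x y : E × E} (hx : x ∈ (trigGraph b M M').topologicalClosure)
    (hy : y ∈ (trigGraph b M M').topologicalClosure) : Q x y = 0 := by
  have hz : ∀ x, Q x 0 = 0 := fun x => by simpa using hsmul 0 x 0
  have hz' : ∀ y, Q 0 y = 0 := fun y => by simpa using hsmul' 0 0 y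
  have h1 : ∀ k, ∀ y ∈ trigGraph b M M', Q (b k, basisAction b M M' k) y = 0 := by
    intro k y hy
    induction hy using Submodule.span_induction with
    | mem y hy => obtain ⟨l, rfl⟩ := hy; exact h k l
    | zero => exact hz _
    | add y z _ _ hy hz => rw [hadd, hy, hz, add_zero]
    | smul c y _ hy => rw [hsmul, hy, mul_zero]
  have h2 : ∀ x ∈ trigGraph b M M', ∀ y ∈ trigGraph b M M', Q x y = 0 := by
    intro x hx y hy
    induction hx using Submodule.span_induction with
    | mem x hx => obtain ⟨k, rfl⟩ := hx; exact h1 k y hy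
    | zero => exact hz' _
    | add x z _ _ hx hz => rw [hadd', hx, hz, add_zero]
    | smul c x _ hx => rw [hsmul', hx, mul_zero]
  have h3 : ∀ x ∈ trigGraph b M M', Q x y = 0 := fun x hx =>
    closure_minimal (s := (trigGraph b M M' : Set (E × E))) (t := {y | Q x y = 0})
      (fun y hy => h2 x hx y hy) (isClosed_eq (hc x) continuous_const) hy
  exact closure_minimal (s := (trigGraph b M M' : Set (E × E))) (t := {x | Q x y = 0})
    (fun x hx => h3 x hx) (isClosed_eq (hc' y) continuous_const) hx

variable [CompleteSpace E]

/-- Essential self-adjointness by Friedrichs mollifiers. If `(u, w)` is in the adjoint graph, then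
`R n u` lies in `H¹`, and the operator maps it to `R n w` plus commutator terms that involve only
`M'` and cancel in the limit. -/
theorem trigGraph_adjoint_le {b : HilbertBasis ℤ ℂ E} {M M' : E →L[ℂ] E}
    (hM : IsSelfAdjoint M) (hM' : IsSelfAdjoint M') (h : IsMatrixDeriv b M M') :
    (trigGraph b M M').adjoint ≤ (trigGraph b M M').topologicalClosure := by
  rintro ⟨u, w⟩ huw
  have hsymm : ∀ x y, inner ℂ (M x) y = inner ℂ x (M y) :=
    ContinuousLinearMap.isSelfAdjoint_iff_isSymmetric.1 hM
  have hsymm' : ∀ x y, inner ℂ (M' x) y = inner ℂ x (M' y) :=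
    ContinuousLinearMap.isSelfAdjoint_iff_isSymmetric.1 hM'
  have hw : ∀ l : ℤ, inner ℂ (b l) w
      = -(l : ℂ) * inner ℂ (b l) (M u) - Complex.I / 2 * inner ℂ (b l) (M' u) := by
    intro l
    have h1 := (Submodule.mem_adjoint_iff _ _).1 huw (b l) (basisAction b M M' l)
      (Submodule.subset_span ⟨l, rfl⟩)
    rw [basisAction, inner_add_left, inner_neg_left, inner_smul_left, inner_smul_left, hsymm,
      hsymm'] at h1
    simp only [map_intCast, map_div₀, Complex.conj_I, map_ofNat] at h1
    linear_combination -h1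
  set R : ℕ → E →L[ℂ] E := fun n => resolvent b (1 / ((n : ℝ) + 1)) with hR
  -- The second entry is the value of the operator at `R n u`; the three terms with `M'` have limits
  -- with coefficients `i/2`, `-i`, `i/2`, whose sum is zero.
  have key : ∀ n, (R n u, R n w + (Complex.I / 2) • R n (M' u) - Complex.I • R n (M' (R n u))
      + (Complex.I / 2) • M' (R n u)) ∈ (trigGraph b M M').topologicalClosure := by
    intro n
    set ε : ℝ := 1 / ((n : ℝ) + 1) with hε
    have hε0 : (ε : ℂ) ≠ 0 := by
      have : (ε : ℝ) ≠ 0 := by positivity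
      exact_mod_cast this
    have hcomm := fun x => congrArg (fun T : E →L[ℂ] E => T x) (resolvent_mul_sub h ε)
    simp only [sub_apply, smul_apply, mul_apply_eq_comp] at hcomm
    have hcoef : ∀ k : ℤ, (Complex.I * ε)⁻¹ * (resolventCoeff ε k - 1)
        = -(k : ℂ) * resolventCoeff ε k := by
      intro k
      have hk := one_add_I_mul_ne_zero ε k
      have hI := Complex.I_ne_zero
      simp only [resolventCoeff]
      field_simp
      ring
    have hmem := mem_closure_trigGraph (b := b) (M := M) (M' := M') (u := R n u)
      -- By `hcoef` this vector is `-D R u`, with `D` the diagonal operator with entries `k`.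
      (v := (Complex.I * ε)⁻¹ • (R n u - u)) (fun k => by
        simp only [hR, resolvent, ← hε, inner_smul_right, inner_sub_right, inner_diagOp]
        linear_combination inner ℂ (b k) u * hcoef k)
    convert! hmem using 2
    rw [add_left_inj]
    have hRw : R n w = (Complex.I * ε)⁻¹ • (R n (M u) - M u) - (Complex.I / 2) • R n (M' u) :=
      hilbertBasis_ext b fun k => by
        simp only [hR, resolvent, ← hε, inner_smul_right, inner_sub_right, inner_diagOp, hw]
        linear_combination -inner ℂ (b k) (M u) * hcoef k
    have hMR : M (R n u) = R n (M u) + (ε : ℂ) • R n (M' (R n u)) := by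
      have := hcomm u
      rw [sub_eq_iff_eq_add'] at this
      exact this
    rw [map_smul, map_sub, hMR, hRw]
    have e : (Complex.I * ε)⁻¹ * (ε : ℂ) = -Complex.I := by
      rw [mul_inv, mul_assoc, inv_mul_cancel₀ hε0, mul_one, Complex.inv_I]
    have e2 : (Complex.I * (ε : ℂ))⁻¹ • (R n (M u) + (ε : ℂ) • R n (M' (R n u)) - M u)
        = (Complex.I * (ε : ℂ))⁻¹ • (R n (M u) - M u) + (-Complex.I) • R n (M' (R n u)) := by
      rw [← e, mul_smul, ← smul_add]; congr 1; abel
    rw [e2, neg_smul]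
    abel
  have t1 : Tendsto (fun n => R n u) atTop (𝓝 u) := tendsto_resolvent b tendsto_const_nhds
  have t2 : Tendsto (fun n => M' (R n u)) atTop (𝓝 (M' u)) := (M'.continuous.tendsto u).comp t1
  have t3 := (((tendsto_resolvent b (tendsto_const_nhds (x := w))).add
    ((tendsto_resolvent b (tendsto_const_nhds (x := M' u))).const_smul (Complex.I / 2))).sub
    ((tendsto_resolvent b t2).const_smul Complex.I)).add (t2.const_smul (Complex.I / 2))
  have e : w + (Complex.I / 2) • M' u - Complex.I • M' u + (Complex.I / 2) • M' u = w := by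
    have : (Complex.I / 2) • M' u + (Complex.I / 2) • M' u = Complex.I • M' u := by
      rw [← add_smul, add_halves]
    rw [← this]; abel
  rw [e] at t3
  exact (trigGraph b M M').isClosed_topologicalClosure.mem_of_tendsto (t1.prodMk_nhds t3)
    (Eventually.of_forall key)

theorem closure_trigGraph_le_adjoint {b : HilbertBasis ℤ ℂ E} {M M' : E →L[ℂ] E}
    (hM : IsSelfAdjoint M) (h : IsMatrixDeriv b M M') :
    (trigGraph b M M').topologicalClosure ≤ (trigGraph b M M').topologicalClosure.adjoint := by
  have hsymm : ∀ x y, inner ℂ (M x) y = inner ℂ x (M y) :=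
    ContinuousLinearMap.isSelfAdjoint_iff_isSymmetric.1 hM
  intro y hy
  rw [Submodule.mem_adjoint_iff]
  intro x₁ x₂ hx
  refine closure_trigGraph_induction (b := b) (M := M) (M' := M')
    (Q := fun x y => inner ℂ x.2 y.1 - inner ℂ x.1 y.2) ?_ ?_ ?_ ?_ ?_ ?_ ?_ hx hy
  · intro x y z; simp only [Prod.fst_add, Prod.snd_add, inner_add_right]; ring
  · intro c x y; simp only [Prod.smul_fst, Prod.smul_snd, inner_smul_right]; ring
  · intro x y z; simp only [Prod.fst_add, Prod.snd_add, inner_add_left]; ring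
  · intro c x y; simp only [Prod.smul_fst, Prod.smul_snd, inner_smul_left]; ring
  · intro x; fun_prop
  · intro x; fun_prop
  · intro k l
    have e : inner ℂ (basisAction b M M' k) (b l)
        = -(((k : ℂ) + l) / 2) * inner ℂ (b k) (M (b l)) := by
      rw [← inner_conj_symm, inner_basis_basisAction h, map_mul, inner_conj_symm, hsymm]
      simp only [map_neg, map_div₀, map_add, map_intCast, map_ofNat]
      rw [add_comm (l : ℂ)]
    simp only [e, inner_basis_basisAction h, sub_self]

theorem closure_trigGraph_adjoint {b : HilbertBasis ℤ ℂ E} {M M' : E →L[ℂ] E}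
    (hM : IsSelfAdjoint M) (hM' : IsSelfAdjoint M') (h : IsMatrixDeriv b M M') :
    (trigGraph b M M').topologicalClosure.adjoint = (trigGraph b M M').topologicalClosure := by
  refine le_antisymm (fun x hx => trigGraph_adjoint_le hM hM' h ?_)
    (closure_trigGraph_le_adjoint hM h)
  rw [Submodule.mem_adjoint_iff] at hx ⊢
  exact fun a c hac => hx a c (Submodule.le_topologicalClosure _ hac)

/-- The commutator of multiplication by `λ` with `(i/2)(F d/dp + d/dp F)`. -/
theorem closure_trigGraph_commutator {b : HilbertBasis ℤ ℂ E} {M M' L Z : E →L[ℂ] E}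
    (hM : IsSelfAdjoint M) (hM' : IsSelfAdjoint M') (hLM : M * L = L * M) (hLM' : M' * L = L * M')
    (h : IsMatrixDeriv b (L * M) (Z + L * M')) {x y : E × E}
    (hx : x ∈ (trigGraph b M M').topologicalClosure)
    (hy : y ∈ (trigGraph b M M').topologicalClosure) :
    inner ℂ x.1 (Z y.1) = Complex.I * (inner ℂ x.1 (L y.2) - inner ℂ x.2 (L y.1)) := by
  have hsymm : ∀ x y, inner ℂ (M x) y = inner ℂ x (M y) :=
    ContinuousLinearMap.isSelfAdjoint_iff_isSymmetric.1 hM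
  have hsymm' : ∀ x y, inner ℂ (M' x) y = inner ℂ x (M' y) :=
    ContinuousLinearMap.isSelfAdjoint_iff_isSymmetric.1 hM'
  rw [← sub_eq_zero]
  refine closure_trigGraph_induction (b := b) (M := M) (M' := M')
    (Q := fun x y => inner ℂ x.1 (Z y.1)
      - Complex.I * (inner ℂ x.1 (L y.2) - inner ℂ x.2 (L y.1))) ?_ ?_ ?_ ?_ ?_ ?_ ?_ hx hy
  · intro x y z; simp only [Prod.fst_add, Prod.snd_add, inner_add_right, map_add]; ring
  · intro c x y; simp only [Prod.smul_fst, Prod.smul_snd, inner_smul_right, map_smul]; ring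
  · intro x y z; simp only [Prod.fst_add, Prod.snd_add, inner_add_left]; ring
  · intro c x y; simp only [Prod.smul_fst, Prod.smul_snd, inner_smul_left]; ring
  · intro x; fun_prop
  · intro x; fun_prop
  -- After `M` and `M'` are moved past `L`, all that is left is the matrix form of `(λF)' = ζ(λ) +
  -- λF'`, that is, of `λ'F = ζ(λ)`.
  · intro k l
    have h1 := h k l
    have h2 : M (L (b l)) = L (M (b l)) := congrArg (fun T : E →L[ℂ] E => T (b l)) hLM
    have h3 : M' (L (b l)) = L (M' (b l)) := congrArg (fun T : E →L[ℂ] E => T (b l)) hLM'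
    simp only [add_apply, mul_apply_eq_comp, inner_add_right] at h1
    simp only [basisAction, map_add, map_neg, map_smul, inner_add_right, inner_neg_right,
      inner_smul_right, inner_add_left, inner_neg_left, inner_smul_left, hsymm, hsymm', h2, h3,
      map_div₀, Complex.conj_I, map_ofNat, map_intCast]
    linear_combination h1 - inner ℂ (b k) (L (M' (b l))) * Complex.I_mul_I

end FourierBasis

/-! ### Functions on the circle -/

/-- The normalised measure on the circle. -/
noncomputable abbrev haarT : Measure Torus := AddCircle.haarAddCircle (T := 2 * π)

/-- The representative of a point of the circle in `(-π, π]`. -/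
noncomputable def angle (x : Torus) : ℝ := (AddCircle.equivIoc (2 * π) (-π) x : ℝ)

theorem coe_angle (x : Torus) : ((angle x : ℝ) : Torus) = x := AddCircle.coe_equivIoc

theorem angle_coe {p : ℝ} (hp : p ∈ Ioc (-π) π) : angle (p : Torus) = p :=
  AddCircle.equivIoc_coe_of_mem (by rwa [show -π + 2 * π = π by ring])

theorem quasiMeasurePreserving_angle :
    Measure.QuasiMeasurePreserving angle haarT (volume.restrict (Ioc (-π) π)) := by
  have h1 := AddCircle.measurePreserving_equivIoc (2 * π) (a := -π)
  have h2 := measurePreserving_subtype_coe (μa := (volume : Measure ℝ))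
    (measurableSet_Ioc (a := -π) (b := -π + 2 * π))
  have h3 : Measure.QuasiMeasurePreserving angle volume
      (volume.restrict (Ioc (-π) (-π + 2 * π))) := (h2.comp h1).quasiMeasurePreserving
  rw [show -π + 2 * π = π by ring] at h3
  refine h3.mono_left ?_
  rw [AddCircle.volume_eq_smul_haarAddCircle]
  exact Measure.absolutelyContinuous_smul (by simp [Real.pi_pos])

theorem ae_torus {P : Torus → Prop} (h : ∀ᵐ p ∂(volume.restrict (Ioc (-π) π)), P ((p : ℝ) : Torus)) :
    ∀ᵐ x ∂haarT, P x := by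
  filter_upwards [quasiMeasurePreserving_angle.ae h] with x hx
  rwa [coe_angle] at hx

theorem ae_Ioc_mem_Ioo : ∀ᵐ p ∂(volume.restrict (Ioc (-π) π)), p ∈ Ioo (-π) π := by
  rw [← restrict_Ioo_eq_restrict_Ioc]
  exact ae_restrict_mem measurableSet_Ioo

theorem ae_torus_of_Ioo {P : Torus → Prop} (h : ∀ p ∈ Ioo (-π) π, P ((p : ℝ) : Torus)) :
    ∀ᵐ x ∂haarT, P x :=
  ae_torus (ae_Ioc_mem_Ioo.mono h)

/-- The point `π` of the circle is null, so a jump there does no harm. -/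
theorem aestronglyMeasurable_torus {E : Type*} [TopologicalSpace E]
    [TopologicalSpace.PseudoMetrizableSpace E] {f : Torus → E}
    (h : ContinuousOn (fun p : ℝ => f (p : Torus)) (Ioo (-π) π)) [SecondCountableTopologyEither ℝ E] :
    AEStronglyMeasurable f haarT := by
  have h1 : AEStronglyMeasurable (fun p : ℝ => f (p : Torus)) (volume.restrict (Ioc (-π) π)) := by
    rw [← restrict_Ioo_eq_restrict_Ioc]
    exact h.aestronglyMeasurable measurableSet_Ioo
  have h2 := h1.comp_quasiMeasurePreserving quasiMeasurePreserving_angle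
  exact h2.congr (Eventually.of_forall fun x => congrArg f (coe_angle x))

theorem memLp_torus {f : Torus → ℂ} (h : ContinuousOn (fun p : ℝ => f (p : Torus)) (Ioo (-π) π))
    {C : ℝ} (hC : ∀ p ∈ Ioo (-π) π, ‖f ((p : ℝ) : Torus)‖ ≤ C) (q : ℝ≥0∞) : MemLp f q haarT :=
  MemLp.of_bound (aestronglyMeasurable_torus h) C (ae_torus_of_Ioo hC)

theorem fourierCoeff_eq_integral (f : Torus → ℂ) (n : ℤ) :
    fourierCoeff f n = (1 / (2 * π)) • ∫ p in (-π)..π, fourier (-n) (p : Torus) • f (p : Torus) := by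
  rw [fourierCoeff_eq_intervalIntegral f n (-π), show -π + 2 * π = π by ring]

/-- The Fourier coefficients of the derivative of a `C¹` function with equal boundary values. -/
theorem fourierCoeff_deriv {f f' : Torus → ℂ} {Φ Φ' : ℝ → ℂ}
    (hΦ : ∀ p ∈ Icc (-π) π, HasDerivAt Φ (Φ' p) p) (hΦ' : ContinuousOn Φ' (Icc (-π) π))
    (hper : Φ (-π) = Φ π) (hf : ∀ p ∈ Ioo (-π) π, f (p : Torus) = Φ p)
    (hf' : ∀ p ∈ Ioo (-π) π, f' (p : Torus) = Φ' p) (n : ℤ) :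
    fourierCoeff f' n = Complex.I * n * fourierCoeff f n := by
  have hpi : -π ≤ π := by linarith [Real.pi_pos]
  have hcongr : ∀ {g : Torus → ℂ} {G : ℝ → ℂ}, (∀ p ∈ Ioo (-π) π, g (p : Torus) = G p) →
      ∫ p in (-π)..π, fourier (-n) (p : Torus) • g (p : Torus)
        = ∫ p in (-π)..π, fourier (-n) (p : Torus) * G p := by
    intro g G h
    rw [intervalIntegral.integral_of_le hpi, intervalIntegral.integral_of_le hpi]
    refine integral_congr_ae ?_
    filter_upwards [ae_Ioc_mem_Ioo] with p hp
    rw [h p hp, smul_eq_mul]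
  rw [fourierCoeff_eq_integral, fourierCoeff_eq_integral, hcongr hf, hcongr hf']
  have hfd : ∀ p : ℝ, HasDerivAt (fun q : ℝ => fourier (-n) (q : Torus))
      (-Complex.I * n * fourier (-n) (p : Torus)) p := by
    intro p
    convert hasDerivAt_fourier_neg (2 * π) n p using 1
    have : (π : ℂ) ≠ 0 := by exact_mod_cast Real.pi_ne_zero
    push_cast
    field_simp
  have hper' : fourier (-n) ((-π : ℝ) : Torus) = fourier (-n) ((π : ℝ) : Torus) := by
    congr 1
    have := AddCircle.coe_add_period (2 * π) (-π)
    rw [← this]; congr 1; ring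
  have hcf : ContinuousOn (fun p : ℝ => fourier (-n) (p : Torus)) (Icc (-π) π) :=
    fun p _ => (hfd p).continuousAt.continuousWithinAt
  have hcΦ : ContinuousOn Φ (Icc (-π) π) := fun p hp => (hΦ p hp).continuousAt.continuousWithinAt
  have hu : uIcc (-π) π = Icc (-π) π := uIcc_of_le hpi
  have hibp := intervalIntegral.integral_mul_deriv_eq_deriv_mul (a := -π) (b := π)
    (u := fun p : ℝ => fourier (-n) (p : Torus)) (v := Φ) (v' := Φ')
    (u' := fun p : ℝ => -Complex.I * n * fourier (-n) (p : Torus))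
    (fun p _ => hfd p) (fun p hp => hΦ p (hu ▸ hp))
    ((ContinuousOn.mul continuousOn_const (hu.symm ▸ hcf)).intervalIntegrable)
    ((hu.symm ▸ hΦ' : ContinuousOn Φ' (uIcc (-π) π)).intervalIntegrable)
  -- The boundary terms of the integration by parts cancel because `Φ` has equal end values;
  -- equality of the end values of `Φ'` plays no part.
  rw [hibp, hper', hper, sub_self, zero_sub]
  have : ∀ p : ℝ, -Complex.I * n * fourier (-n) (p : Torus) * Φ p
      = (-Complex.I * n) * (fourier (-n) (p : Torus) * Φ p) := fun p => by ring
  simp only [this]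
  rw [intervalIntegral.integral_const_mul]
  simp only [Complex.real_smul]
  ring

/-! ### Multiplication operators -/

open Classical in
/-- Multiplication by a bounded measurable function in `L²(𝕋)`. -/
noncomputable def mulOp (f : Torus → ℂ) : L2T →L[ℂ] L2T :=
  if h : MemLp f ∞ haarT then
    (ContinuousLinearMap.mul ℂ ℂ).holderL haarT ∞ 2 2 (h.toLp f) else 0

theorem coeFn_mulOp {f : Torus → ℂ} (hf : MemLp f ∞ haarT) (u : L2T) :
    mulOp f u =ᵐ[haarT] fun x => f x * u x := by
  rw [mulOp, dif_pos hf, ContinuousLinearMap.holderL_apply_apply]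
  filter_upwards [(ContinuousLinearMap.mul ℂ ℂ).coeFn_holder (r := 2) (hf.toLp f) u,
    hf.coeFn_toLp] with x h1 h2
  rw [h1, h2, ContinuousLinearMap.mul_apply']

theorem mulOp_eq {f : Torus → ℂ} (hf : MemLp f ∞ haarT) {u v : L2T}
    (h : ∀ᵐ x ∂haarT, v x = f x * u x) : mulOp f u = v := by
  apply Lp.ext
  filter_upwards [coeFn_mulOp hf u, h] with x h1 h2
  rw [h1, h2]

theorem mulOp_mul {f g : Torus → ℂ} (hf : MemLp f ∞ haarT) (hg : MemLp g ∞ haarT) :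
    mulOp f * mulOp g = mulOp (fun x => f x * g x) := by
  have hfg : MemLp (fun x => f x * g x) ∞ haarT := hg.mul hf
  ext1 u
  refine (mulOp_eq hfg ?_).symm
  filter_upwards [coeFn_mulOp hf (mulOp g u), coeFn_mulOp hg u] with x h1 h2
  rw [mul_apply_eq_comp, h1, h2, mul_assoc]

theorem mulOp_add {f g : Torus → ℂ} (hf : MemLp f ∞ haarT) (hg : MemLp g ∞ haarT) :
    mulOp f + mulOp g = mulOp (fun x => f x + g x) := by
  ext1 u
  refine (mulOp_eq (hf.add hg) ?_).symm
  filter_upwards [coeFn_mulOp hf u, coeFn_mulOp hg u, Lp.coeFn_add (mulOp f u) (mulOp g u)]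
    with x h1 h2 h3
  rw [add_apply, h3, Pi.add_apply, h1, h2, Pi.add_apply, add_mul]

theorem mulOp_const (c : ℂ) : mulOp (fun _ => c) = c • 1 := by
  ext1 u
  refine mulOp_eq (memLp_const c) ?_
  filter_upwards [Lp.coeFn_smul c u] with x h
  rw [smul_apply, one_apply_eq_self, h, Pi.smul_apply, smul_eq_mul]

theorem mulOp_smul {f : Torus → ℂ} (hf : MemLp f ∞ haarT) (c : ℂ) :
    c • mulOp f = mulOp (fun x => c * f x) := by
  rw [← mulOp_mul (memLp_const c) hf, mulOp_const, smul_mul_assoc, one_mul]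

theorem mulOp_sum {ι : Type*} (s : Finset ι) {f : ι → Torus → ℂ}
    (hf : ∀ i ∈ s, MemLp (f i) ∞ haarT) :
    ∑ i ∈ s, mulOp (f i) = mulOp (fun x => ∑ i ∈ s, f i x) := by
  classical
  induction s using Finset.induction_on with
  | empty => simp [mulOp_const]
  | insert i s hi ih =>
    rw [Finset.sum_insert hi, ih fun j hj => hf j (Finset.mem_insert_of_mem hj),
      mulOp_add (hf i (Finset.mem_insert_self _ _))
        (memLp_finsetSum s fun j hj => hf j (Finset.mem_insert_of_mem hj))]
    simp only [Finset.sum_insert hi]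

theorem mulOp_comm {f g : Torus → ℂ} (hf : MemLp f ∞ haarT) (hg : MemLp g ∞ haarT) :
    mulOp f * mulOp g = mulOp g * mulOp f := by
  rw [mulOp_mul hf hg, mulOp_mul hg hf]
  simp only [mul_comm]

theorem adjoint_mulOp {f : Torus → ℂ} (hf : MemLp f ∞ haarT) :
    ContinuousLinearMap.adjoint (mulOp f) = mulOp (fun x => (starRingEnd ℂ) (f x)) := by
  have hf' : MemLp (fun x => (starRingEnd ℂ) (f x)) ∞ haarT := hf.star
  symm
  rw [ContinuousLinearMap.eq_adjoint_iff]
  intro u v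
  rw [L2.inner_def, L2.inner_def]
  refine integral_congr_ae ?_
  filter_upwards [coeFn_mulOp hf' u, coeFn_mulOp hf v] with x h1 h2
  simp only [h1, h2, RCLike.inner_apply, map_mul, Complex.conj_conj]
  ring

theorem isSelfAdjoint_mulOp {f : Torus → ℝ} (hf : MemLp (fun x => (f x : ℂ)) ∞ haarT) :
    IsSelfAdjoint (mulOp fun x => (f x : ℂ)) := by
  rw [ContinuousLinearMap.isSelfAdjoint_iff', adjoint_mulOp hf]
  simp only [Complex.conj_ofReal]

theorem norm_mulOp_le {f : Torus → ℂ} {C : ℝ} (hC0 : 0 ≤ C) (hC : ∀ᵐ x ∂haarT, ‖f x‖ ≤ C) :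
    ‖mulOp f‖ ≤ C := by
  by_cases hf : MemLp f ∞ haarT
  · refine ContinuousLinearMap.opNorm_le_bound _ hC0 fun u => ?_
    refine Lp.norm_le_mul_norm_of_ae_le_mul ?_
    filter_upwards [coeFn_mulOp hf u, hC] with x h1 h2
    rw [h1, norm_mul]
    gcongr
  · rw [mulOp, dif_neg hf, norm_zero]
    exact hC0

theorem inner_fourierBasis (k : ℤ) (u : L2T) :
    inner ℂ (fourierBasis k : L2T) u = fourierCoeff u k := by
  rw [← fourierBasis.repr_apply_apply, fourierBasis_repr]

theorem coeFn_fourierBasis (l : ℤ) : (fourierBasis l : L2T) =ᵐ[haarT] fourier l := by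
  rw [coe_fourierBasis]; exact coeFn_fourierLp 2 l

theorem inner_mulOp_fourierBasis {f : Torus → ℂ} (hf : MemLp f ∞ haarT) (k l : ℤ) :
    inner ℂ (fourierBasis k : L2T) (mulOp f (fourierBasis l)) = fourierCoeff f (k - l) := by
  rw [inner_fourierBasis, fourierCoeff, fourierCoeff]
  refine integral_congr_ae ?_
  filter_upwards [coeFn_mulOp hf (fourierBasis l), coeFn_fourierBasis l] with x h1 h2
  rw [h1, h2, show -(k - l) = -k + l by ring, fourier_add, smul_eq_mul, smul_eq_mul]
  ring

/-- The matrix of a multiplication depends only on `k - l`, so the condition on matrices reduces to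
one on Fourier coefficients. -/
theorem isMatrixDeriv_mulOp {f f' : Torus → ℂ} (hf : MemLp f ∞ haarT) (hf' : MemLp f' ∞ haarT)
    (h : ∀ n : ℤ, fourierCoeff f' n = Complex.I * n * fourierCoeff f n) :
    IsMatrixDeriv (fourierBasis (T := 2 * π)) (mulOp f) (mulOp f') := by
  intro k l
  rw [inner_mulOp_fourierBasis hf, inner_mulOp_fourierBasis hf', h]
  push_cast
  ring

/-! ### The conjugate operator of one branch -/

/-- A real function on the line, restricted to `(-π, π]` and seen as a function on the circle. -/
noncomputable def onCircle (F : ℝ → ℝ) (x : Torus) : ℂ := (F (angle x) : ℂ)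

theorem onCircle_coe (F : ℝ → ℝ) {p : ℝ} (hp : p ∈ Ioc (-π) π) :
    onCircle F (p : Torus) = F p := by
  rw [onCircle, angle_coe hp]

/-- `F` agrees on `(-π, π)` with a function that is `C¹` on `[-π, π]` and takes equal values at the
two end points. -/
structure IsRegularField (F Φ Φ' : ℝ → ℝ) : Prop where
  hasDerivAt : ∀ p ∈ Icc (-π) π, HasDerivAt Φ (Φ' p) p
  continuousOn : ContinuousOn Φ' (Icc (-π) π)
  boundary : Φ (-π) = Φ π
  eq : ∀ p ∈ Ioo (-π) π, F p = Φ p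

namespace IsRegularField

variable {F Φ Φ' : ℝ → ℝ} (h : IsRegularField F Φ Φ')

include h

theorem deriv_eq {p : ℝ} (hp : p ∈ Ioo (-π) π) : deriv F p = Φ' p := by
  have : F =ᶠ[𝓝 p] Φ := by
    filter_upwards [isOpen_Ioo.mem_nhds hp] with q hq using h.eq q hq
  rw [this.deriv_eq]
  exact (h.hasDerivAt p (Ioo_subset_Icc_self hp)).deriv

theorem continuousOn_self : ContinuousOn Φ (Icc (-π) π) :=
  fun p hp => (h.hasDerivAt p hp).continuousAt.continuousWithinAt

theorem memLp : MemLp (onCircle F) ∞ haarT := by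
  obtain ⟨C, hC⟩ := isCompact_Icc.exists_bound_of_continuousOn h.continuousOn_self
  have e : ∀ p ∈ Ioo (-π) π, onCircle F (p : Torus) = (Φ p : ℂ) := fun p hp => by
    rw [onCircle_coe F (Ioo_subset_Ioc_self hp), h.eq p hp]
  refine memLp_torus (C := C) ?_ (fun p hp => ?_) _
  · exact (Complex.continuous_ofReal.comp_continuousOn
      (h.continuousOn_self.mono Ioo_subset_Icc_self)).congr e
  · rw [e p hp, Complex.norm_real]; exact hC p (Ioo_subset_Icc_self hp)

theorem memLp_deriv : MemLp (onCircle (deriv F)) ∞ haarT := by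
  obtain ⟨C, hC⟩ := isCompact_Icc.exists_bound_of_continuousOn h.continuousOn
  have e : ∀ p ∈ Ioo (-π) π, onCircle (deriv F) (p : Torus) = (Φ' p : ℂ) := fun p hp => by
    rw [onCircle_coe _ (Ioo_subset_Ioc_self hp), h.deriv_eq hp]
  refine memLp_torus (C := C) ?_ (fun p hp => ?_) _
  · exact (Complex.continuous_ofReal.comp_continuousOn
      (h.continuousOn.mono Ioo_subset_Icc_self)).congr e
  · rw [e p hp, Complex.norm_real]; exact hC p (Ioo_subset_Icc_self hp)

theorem isMatrixDeriv : IsMatrixDeriv (fourierBasis (T := 2 * π)) (mulOp (onCircle F))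
    (mulOp (onCircle (deriv F))) := by
  refine isMatrixDeriv_mulOp h.memLp h.memLp_deriv fun n => ?_
  refine fourierCoeff_deriv (Φ := fun p => (Φ p : ℂ)) (Φ' := fun p => (Φ' p : ℂ))
    (fun p hp => (h.hasDerivAt p hp).ofReal_comp)
    (Complex.continuous_ofReal.comp_continuousOn h.continuousOn) (by rw [h.boundary]) ?_ ?_ n
  · intro p hp
    rw [onCircle_coe F (Ioo_subset_Ioc_self hp), h.eq p hp]
  · intro p hp
    rw [onCircle_coe _ (Ioo_subset_Ioc_self hp), h.deriv_eq hp]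

omit h in
theorem isSelfAdjoint_onCircle (hF : MemLp (onCircle F) ∞ haarT) :
    IsSelfAdjoint (mulOp (onCircle F)) :=
  isSelfAdjoint_mulOp (f := fun x => F (angle x)) hF

/-- The graph of the branch operator on trigonometric polynomials. -/
theorem trigGraph_le : trigGraph (fourierBasis (T := 2 * π)) (mulOp (onCircle F))
    (mulOp (onCircle (deriv F))) ≤ branchGraph F := by
  refine Submodule.span_le.2 ?_
  rintro _ ⟨l, rfl⟩
  have hd : ∀ p : ℝ, HasDerivAt (fun q : ℝ => fourier l (q : Torus))
      (Complex.I * l * fourier l (p : Torus)) p := by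
    intro p
    convert hasDerivAt_fourier (2 * π) l p using 1
    have : (π : ℂ) ≠ 0 := by exact_mod_cast Real.pi_ne_zero
    push_cast
    field_simp
  refine ⟨fun p => fourier l (p : Torus), ?_, ?_, ?_, ?_⟩
  · have : (fun p : ℝ => fourier l (p : Torus))
        = fun p : ℝ => Complex.exp (2 * π * Complex.I * l * p / ((2 * π : ℝ) : ℂ)) :=
      funext fun p => fourier_coe_apply
    rw [this]
    have h1 : ContDiff ℝ ∞ fun p : ℝ => (p : ℂ) := Complex.ofRealCLM.contDiff
    exact ((contDiff_const.mul h1).div_const _).cexp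
  · intro p
    change fourier l ((p + 2 * π : ℝ) : Torus) = _
    rw [AddCircle.coe_add_period]
  · exact ae_coe (coeFn_fourierBasis l)
  · filter_upwards [ae_coe (coeFn_fourierBasis l),
      ae_coe (coeFn_mulOp h.memLp (fourierBasis l)),
      ae_coe (coeFn_mulOp h.memLp_deriv (fourierBasis l)),
      ae_coe (Lp.coeFn_add (-((l : ℂ) • mulOp (onCircle F) (fourierBasis l)))
        ((Complex.I / 2) • mulOp (onCircle (deriv F)) (fourierBasis l))),
      ae_coe (Lp.coeFn_neg ((l : ℂ) • mulOp (onCircle F) (fourierBasis l))),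
      ae_coe (Lp.coeFn_smul (l : ℂ) (mulOp (onCircle F) (fourierBasis l))),
      ae_coe (Lp.coeFn_smul (Complex.I / 2) (mulOp (onCircle (deriv F)) (fourierBasis l))),
      ae_restrict_mem measurableSet_Ioc] with p h1 h2 h3 h4 h5 h6 h7 hp
    change (basisAction _ _ _ l : L2T) (p : Torus) = _
    rw [basisAction, h4, Pi.add_apply, h5, Pi.neg_apply, h6, Pi.smul_apply, h7, Pi.smul_apply,
      h2, h3, h1, onCircle_coe _ hp, onCircle_coe _ hp, (hd p).deriv, smul_eq_mul, smul_eq_mul]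
    linear_combination (-(l : ℂ) * F p * fourier l (p : Torus)) * Complex.I_mul_I

/-- For smooth periodic `φ` the coefficients of `iφ'` are `-k` times those of `φ`, so
`mem_closure_trigGraph` applies. With `trigGraph_le`, the trigonometric polynomials form a core. -/
theorem branchGraph_le : branchGraph F ≤ (trigGraph (fourierBasis (T := 2 * π))
    (mulOp (onCircle F)) (mulOp (onCircle (deriv F)))).topologicalClosure := by
  rintro ⟨u, w⟩ ⟨φ, hφ, pφ, h1, h2⟩
  simp only at h1 h2
  have hd : ∀ p, HasDerivAt φ (deriv φ p) p := fun p =>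
    (hφ.differentiable (by simp) p).hasDerivAt
  have hcd : Continuous (deriv φ) := hφ.continuous_deriv (by simp)
  have hper : φ (-π) = φ π := by
    rw [← pφ (-π)]; congr 1; ring
  have hang : ∀ p ∈ Ioo (-π) π, angle ((p : ℝ) : Torus) = p := fun p hp =>
    angle_coe (Ioo_subset_Ioc_self hp)
  obtain ⟨C, hC⟩ := isCompact_Icc.exists_bound_of_continuousOn
    (hcd.continuousOn (s := Icc (-π) π))
  have hmem : MemLp (fun x : Torus => Complex.I * deriv φ (angle x)) 2 haarT := by
    refine (memLp_torus (f := fun x : Torus => deriv φ (angle x)) (C := C) ?_ ?_ 2).const_mul _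
    · exact hcd.continuousOn.congr fun p hp => by rw [hang p hp]
    · intro p hp
      rw [hang p hp]; exact hC p (Ioo_subset_Icc_self hp)
  have hu : u =ᵐ[haarT] fun x => φ (angle x) := by
    refine ae_torus ?_
    filter_upwards [h1, ae_restrict_mem measurableSet_Ioc] with p hp hmem
    rw [hp, angle_coe hmem]
  have hv := hmem.coeFn_toLp
  have hcoef : ∀ k : ℤ, inner ℂ (fourierBasis k : L2T) (hmem.toLp _)
      = -(k : ℂ) * inner ℂ (fourierBasis k : L2T) u := by
    intro k
    have e1 : fourierCoeff (fun x : Torus => deriv φ (angle x)) k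
        = Complex.I * k * fourierCoeff (fun x : Torus => φ (angle x)) k :=
      fourierCoeff_deriv (Φ := φ) (Φ' := deriv φ) (fun p _ => hd p) hcd.continuousOn hper
        (fun p hp => by rw [hang p hp]) (fun p hp => by rw [hang p hp]) k
    rw [inner_fourierBasis, inner_fourierBasis, fourierCoeff_congr_ae hv,
      fourierCoeff_congr_ae hu, fourierCoeff.const_mul, e1]
    linear_combination (k : ℂ) * fourierCoeff (fun x : Torus => φ (angle x)) k * Complex.I_mul_I
  have hw : w = mulOp (onCircle F) (hmem.toLp _)
      + (Complex.I / 2) • mulOp (onCircle (deriv F)) u := by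
    apply Lp.ext
    refine ae_torus ?_
    filter_upwards [h1, h2, ae_coe hv, ae_restrict_mem measurableSet_Ioc,
      ae_coe (coeFn_mulOp h.memLp (hmem.toLp _)), ae_coe (coeFn_mulOp h.memLp_deriv u),
      ae_coe (Lp.coeFn_add (mulOp (onCircle F) (hmem.toLp _))
        ((Complex.I / 2) • mulOp (onCircle (deriv F)) u)),
      ae_coe (Lp.coeFn_smul (Complex.I / 2) (mulOp (onCircle (deriv F)) u))]
      with p k1 k2 k3 hp k4 k5 k6 k7
    rw [k2, k6, Pi.add_apply, k7, Pi.smul_apply, k4, k5, k3, k1, angle_coe hp,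
      onCircle_coe _ hp, onCircle_coe _ hp, smul_eq_mul]
    ring
  rw [hw]
  exact mem_closure_trigGraph hcoef

theorem trigGraph_adjoint_closure : (trigGraph (fourierBasis (T := 2 * π)) (mulOp (onCircle F))
    (mulOp (onCircle (deriv F)))).topologicalClosure.adjoint
      = (trigGraph (fourierBasis (T := 2 * π)) (mulOp (onCircle F))
    (mulOp (onCircle (deriv F)))).topologicalClosure :=
  closure_trigGraph_adjoint (isSelfAdjoint_onCircle h.memLp)
    (isSelfAdjoint_onCircle h.memLp_deriv) h.isMatrixDeriv

omit h in
theorem dense_fst_trigGraph (M M' : L2T →L[ℂ] L2T) :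
    Dense (((trigGraph (fourierBasis (T := 2 * π)) M M').map (LinearMap.fst ℂ L2T L2T) :
      Submodule ℂ L2T) : Set L2T) := by
  have hd : Dense (Submodule.span ℂ (range (fourierBasis (T := 2 * π))) : Set L2T) :=
    Submodule.dense_iff_topologicalClosure_eq_top.2 fourierBasis.dense_span
  refine hd.mono ?_
  refine Submodule.span_le.2 ?_
  rintro _ ⟨l, rfl⟩
  exact ⟨_, Submodule.subset_span ⟨l, rfl⟩, rfl⟩

/-- The closed graph equals its adjoint, so the second entry of a vertical pair is orthogonal to the
dense span of the basis. -/
theorem functional {x : L2T × L2T}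
    (hx : x ∈ (trigGraph (fourierBasis (T := 2 * π)) (mulOp (onCircle F))
      (mulOp (onCircle (deriv F)))).topologicalClosure) (hx0 : x.1 = 0) : x.2 = 0 := by
  rw [← h.trigGraph_adjoint_closure, Submodule.mem_adjoint_iff] at hx
  refine (dense_fst_trigGraph (mulOp (onCircle F))
    (mulOp (onCircle (deriv F)))).eq_zero_of_inner_right ℂ ?_
  rintro _ ⟨⟨a, c⟩, hac, rfl⟩
  have := hx a c (Submodule.le_topologicalClosure _ hac)
  rw [hx0, inner_zero_right, zero_sub, neg_eq_zero] at this
  exact this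

/-- `toLinearPMap` and `closure` give the intended operator only when the graph is single-valued and
the operator closable; `functional` supplies both. -/
theorem graph_branchOp : (branchOp F).graph
    = (trigGraph (fourierBasis (T := 2 * π)) (mulOp (onCircle F))
      (mulOp (onCircle (deriv F)))).topologicalClosure := by
  set T := trigGraph (fourierBasis (T := 2 * π)) (mulOp (onCircle F))
      (mulOp (onCircle (deriv F)))
  have hg : (branchGraph F).toLinearPMap.graph = branchGraph F :=
    Submodule.toLinearPMap_graph_eq _ fun x hx h0 => h.functional (h.branchGraph_le hx) h0
  have hcl : (branchGraph F).topologicalClosure = T.topologicalClosure :=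
    le_antisymm (Submodule.topologicalClosure_minimal _ h.branchGraph_le
      T.isClosed_topologicalClosure) (Submodule.topologicalClosure_mono h.trigGraph_le)
  have hclosable : (branchGraph F).toLinearPMap.IsClosable :=
    ⟨T.topologicalClosure.toLinearPMap, by
      rw [Submodule.toLinearPMap_graph_eq _ fun x hx h0 => h.functional hx h0, hg, hcl]⟩
  rw [branchOp, ← hclosable.graph_closure_eq_closure_graph, hg, hcl]

theorem adjoint_graph_branchOp : (branchOp F).graph.adjoint = (branchOp F).graph := by
  rw [h.graph_branchOp, h.trigGraph_adjoint_closure]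

theorem dense_domain_branchOp : Dense ((branchOp F).domain : Set L2T) := by
  refine (dense_fst_trigGraph (mulOp (onCircle F)) (mulOp (onCircle (deriv F)))).mono ?_
  rintro _ ⟨x, hx, rfl⟩
  refine LinearPMap.mem_domain_iff.2 ⟨x.2, ?_⟩
  rw [h.graph_branchOp]
  exact Submodule.le_topologicalClosure _ hx

end IsRegularField

/-! ### The symbol and its eigenvalues -/

theorem toEuclideanCLM_apply {N : ℕ} (B : Mat N) (v : Vec N) (a : Fin N) :
    Matrix.toEuclideanCLM (𝕜 := ℂ) B v a = ∑ b, B a b * v b := by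
  rw [Matrix.ofLp_toEuclideanCLM]
  rfl

theorem norm_entry_le_opNorm {N : ℕ} (B : Mat N) (a b : Fin N) : ‖B a b‖ ≤ opNorm B := by
  have h1 := (Matrix.toEuclideanCLM (𝕜 := ℂ) B).le_opNorm (EuclideanSpace.single b 1)
  have h2 : (Matrix.toEuclideanCLM (𝕜 := ℂ) B (EuclideanSpace.single b 1)) a = B a b := by
    rw [toEuclideanCLM_apply]
    simp
  rw [← h2]
  refine (PiLp.norm_apply_le _ a).trans (h1.trans ?_)
  simp [opNorm]

/-- The entries of the symbol as continuous functions. -/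
noncomputable def symbolEntry {N : ℕ} (A : ℤ → Mat N) (a b : Fin N) : C(Torus, ℂ) :=
  ∑' m : ℤ, A m a b • fourier m

theorem hasSum_symbolEntry {N : ℕ} {A : ℤ → Mat N} (hA : Summable fun m => opNorm (A m))
    (a b : Fin N) : HasSum (fun m : ℤ => A m a b • (fourier m : C(Torus, ℂ)))
      (symbolEntry A a b) := by
  refine Summable.hasSum (Summable.of_norm_bounded hA fun m => ?_)
  rw [norm_smul, fourier_norm, mul_one]
  exact norm_entry_le_opNorm _ _ _

theorem symbol_apply {N : ℕ} {A : ℤ → Mat N} (hA : Summable fun m => opNorm (A m)) (p : Torus)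
    (a b : Fin N) : symbol A p a b = symbolEntry A a b p := by
  have h1 : ∀ a b, HasSum (fun m : ℤ => (fourier m p • A m) a b) (symbolEntry A a b p) := by
    intro a b
    have := (hasSum_symbolEntry hA a b).mapL (ContinuousMap.evalCLM ℂ p)
    refine this.congr_fun ?_ |> id
    intro m
    simp [mul_comm]
  have h2 : HasSum (fun m : ℤ => fourier m p • A m) (Matrix.of fun a b => symbolEntry A a b p) :=
    Pi.hasSum.2 fun a => Pi.hasSum.2 fun b => h1 a b
  rw [symbol, h2.tsum_eq, Matrix.of_apply]

/-- Branches may jump at `p = π`, but the characteristic polynomial cannot. This is what connects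
the value at `π` with the limits from the two sides. -/
theorem continuous_det_symbol {N : ℕ} {A : ℤ → Mat N} (hA : Summable fun m => opNorm (A m))
    (x : ℂ) : Continuous fun p : ℝ => (x • (1 : Mat N) - symbol A (p : Torus)).det := by
  refine Continuous.matrix_det (continuous_const.sub ?_)
  refine continuous_matrix fun a b => ?_
  simp only [symbol_apply hA]
  exact (symbolEntry A a b).continuous.comp (AddCircle.continuous_mk' _)

/-- The matrix whose columns are the vectors `W j p`. -/
def eigenMatrix {N : ℕ} (W : Fin N → Torus → Vec N) (p : Torus) : Mat N :=
  Matrix.of fun a j => W j p a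

theorem eigenMatrix_conjTranspose_mul {N : ℕ} {W : Fin N → Torus → Vec N} {p : Torus}
    (h : Orthonormal ℂ fun j => W j p) :
    (eigenMatrix W p).conjTranspose * eigenMatrix W p = 1 := by
  ext j k
  rw [Matrix.mul_apply, Matrix.one_apply, ← orthonormal_iff_ite.1 h j k, PiLp.inner_apply]
  simp [eigenMatrix, mul_comm]

theorem det_symbol_eq {N : ℕ} {h : Torus → Mat N} {lam : Fin N → Torus → ℝ}
    {W : Fin N → Torus → Vec N} (hs : IsEigensystem h lam W) (p : Torus) (x : ℂ) :
    (x • (1 : Mat N) - h p).det = ∏ j, (x - lam j p) := by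
  have h1 := eigenMatrix_conjTranspose_mul (hs.orthonormal p)
  have h2 : (eigenMatrix W p).det ≠ 0 := by
    intro h0
    have := congrArg Matrix.det h1
    rw [Matrix.det_mul, h0, mul_zero, Matrix.det_one] at this
    exact zero_ne_one this
  have h3 : (x • (1 : Mat N) - h p) * eigenMatrix W p
      = eigenMatrix W p * Matrix.diagonal fun j => x - lam j p := by
    ext a j
    have he := congrArg (fun v : Vec N => v a) (hs.eigen p j)
    simp only [toEuclideanCLM_apply, PiLp.smul_apply, smul_eq_mul] at he
    rw [sub_mul, Matrix.sub_apply, Matrix.mul_diagonal, smul_mul_assoc, one_mul,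
      Matrix.smul_apply, Matrix.mul_apply]
    simp only [eigenMatrix, Matrix.of_apply, he, smul_eq_mul]
    ring
  have h4 := congrArg Matrix.det h3
  rw [Matrix.det_mul, Matrix.det_mul, mul_comm, Matrix.det_diagonal] at h4
  exact mul_left_cancel₀ h2 h4

/-- Equal monic polynomials have the same roots with multiplicity. -/
theorem card_eq_of_prod_eq {N : ℕ} {a c : Fin N → ℝ}
    (h : ∀ x : ℂ, ∏ j, (x - a j) = ∏ j, (x - c j)) (μ : ℝ) :
    (Finset.univ.filter fun j => a j = μ).card = (Finset.univ.filter fun j => c j = μ).card := by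
  classical
  have h1 : ((Finset.univ.val.map fun j => (a j : ℂ)).map
        fun z => Polynomial.X - Polynomial.C z).prod
      = ((Finset.univ.val.map fun j => (c j : ℂ)).map
        fun z => Polynomial.X - Polynomial.C z).prod := by
    refine Polynomial.funext fun x => ?_
    rw [Multiset.map_map, Multiset.map_map]
    change Polynomial.eval x (∏ j, (Polynomial.X - Polynomial.C (a j : ℂ)))
      = Polynomial.eval x (∏ j, (Polynomial.X - Polynomial.C (c j : ℂ)))
    simpa [Polynomial.eval_prod] using h x
  have h2 := congrArg Polynomial.roots h1
  rw [Polynomial.roots_multiset_prod_X_sub_C, Polynomial.roots_multiset_prod_X_sub_C] at h2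
  have h3 := congrArg (Multiset.count (μ : ℂ)) h2
  rw [Multiset.count_map, Multiset.count_map] at h3
  simpa [Finset.card, Finset.filter, Complex.ofReal_inj, eq_comm] using h3

/-! ### Behaviour of the eigenvalue branches across `p = π`. -/

theorem coe_neg_pi : ((-π : ℝ) : Torus) = ((π : ℝ) : Torus) := by
  have := AddCircle.coe_add_period (2 * π) (-π)
  rw [← this]; congr 1; ring

theorem ae_nhdsLT_pi : ∀ᶠ p in 𝓝[<] π, p ∈ Ioo (-π) π :=
  Ioo_mem_nhdsLT (by linarith [Real.pi_pos])

theorem ae_nhdsGT_neg_pi : ∀ᶠ p in 𝓝[>] (-π), p ∈ Ioo (-π) π :=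
  Ioo_mem_nhdsGT (by linarith [Real.pi_pos])

/-- The eigenvalues at `p = π` are the boundary values of the branches, on either side. -/
theorem card_boundary {N : ℕ} {A : ℤ → Mat N} (hA : Summable fun m => opNorm (A m))
    {lam : Fin N → Torus → ℝ} {W : Fin N → Torus → Vec N}
    (hs : IsEigensystem (symbol A) lam W) {g : Fin N → ℝ → ℝ} (hg : ∀ j, Continuous (g j))
    (hlg : ∀ j, ∀ p ∈ Ioo (-π) π, lam j (p : Torus) = g j p) (μ : ℝ) :
    (Finset.univ.filter fun j => lam j (π : Torus) = μ).card
        = (Finset.univ.filter fun j => g j π = μ).card ∧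
      (Finset.univ.filter fun j => lam j (π : Torus) = μ).card
        = (Finset.univ.filter fun j => g j (-π) = μ).card := by
  have hcont : ∀ x : ℂ, Continuous fun p : ℝ => ∏ j, (x - g j p) := fun x =>
    continuous_finsetProd _ fun j _ =>
      continuous_const.sub (Complex.continuous_ofReal.comp (hg j))
  have hin : ∀ x : ℂ, ∀ p ∈ Ioo (-π) π,
      (x • (1 : Mat N) - symbol A (p : Torus)).det = ∏ j, (x - g j p) := fun x p hp => by
    rw [det_symbol_eq hs]
    exact Finset.prod_congr rfl fun j _ => by rw [hlg j p hp]
  constructor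
  · refine card_eq_of_prod_eq (fun x => ?_) μ
    rw [← det_symbol_eq hs]
    refine tendsto_nhds_unique (f := fun p : ℝ => ∏ j, (x - (g j p : ℂ))) (l := 𝓝[<] π) ?_
      (((hcont x).tendsto π).mono_left nhdsWithin_le_nhds)
    exact (((continuous_det_symbol hA x).tendsto π).mono_left nhdsWithin_le_nhds).congr'
      (ae_nhdsLT_pi.mono fun p hp => hin x p hp)
  · refine card_eq_of_prod_eq (fun x => ?_) μ
    rw [← det_symbol_eq hs, ← coe_neg_pi]
    refine tendsto_nhds_unique (f := fun p : ℝ => ∏ j, (x - (g j p : ℂ))) (l := 𝓝[>] (-π)) ?_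
      (((hcont x).tendsto (-π)).mono_left nhdsWithin_le_nhds)
    exact (((continuous_det_symbol hA x).tendsto (-π)).mono_left nhdsWithin_le_nhds).congr'
      (ae_nhdsGT_neg_pi.mono fun p hp => hin x p hp)

/-- The smooth extension `g` agrees with the periodic function on one side of each end point, and
one-sided values and derivatives determine the two-sided ones. -/
theorem boundary_of_differentiableAt {l : Torus → ℝ} {g : ℝ → ℝ} (hg : ContDiff ℝ ∞ g)
    (hlg : ∀ p ∈ Ioo (-π) π, l (p : Torus) = g p)
    (hd : DifferentiableAt ℝ (fun q : ℝ => l (q : Torus)) π) :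
    g π = l (π : Torus) ∧ g (-π) = l (π : Torus) ∧
      deriv g π = deriv (fun q : ℝ => l (q : Torus)) π ∧
      deriv g (-π) = deriv (fun q : ℝ => l (q : Torus)) π := by
  set f : ℝ → ℝ := fun q => l (q : Torus) with hf
  have hper : Function.Periodic f (2 * π) := fun q => by
    simp only [hf, AddCircle.coe_add_period]
  have hd1 : HasDerivAt f (deriv f π) π := hd.hasDerivAt
  have hd2 : HasDerivAt f (deriv f π) (-π) := by
    have h1 : HasDerivAt f (deriv f π) (-π + 2 * π) := by
      rwa [show -π + 2 * π = π by ring]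
    exact (h1.comp_add_const (-π) (2 * π)).congr_of_eventuallyEq
      (Eventually.of_forall fun q => (hper q).symm)
  have hv : f (-π) = f π := by simp only [hf, coe_neg_pi]
  have hgd : ∀ p, HasDerivAt g (deriv g p) p := fun p =>
    (hg.differentiable (by simp) p).hasDerivAt
  have e1 : f =ᶠ[𝓝[<] π] g := ae_nhdsLT_pi.mono fun p hp => hlg p hp
  have e2 : f =ᶠ[𝓝[>] (-π)] g := ae_nhdsGT_neg_pi.mono fun p hp => hlg p hp
  have v1 : g π = f π := tendsto_nhds_unique
    ((hg.continuous.tendsto π).mono_left nhdsWithin_le_nhds)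
    ((hd1.continuousAt.tendsto.mono_left nhdsWithin_le_nhds).congr' e1)
  have v2 : g (-π) = f (-π) := tendsto_nhds_unique
    ((hg.continuous.tendsto (-π)).mono_left nhdsWithin_le_nhds)
    ((hd2.continuousAt.tendsto.mono_left nhdsWithin_le_nhds).congr' e2)
  refine ⟨v1, v2.trans hv, ?_, ?_⟩
  · have h1 : HasDerivWithinAt g (deriv f π) (Iio π) π :=
      hd1.hasDerivWithinAt.congr_of_eventuallyEq e1.symm v1
    exact (uniqueDiffWithinAt_Iio π).eq_deriv _ (hgd π).hasDerivWithinAt h1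
  · have h1 : HasDerivWithinAt g (deriv f π) (Ioi (-π)) (-π) :=
      hd2.hasDerivWithinAt.congr_of_eventuallyEq e2.symm v2
    exact (uniqueDiffWithinAt_Ioi (-π)).eq_deriv _ (hgd (-π)).hasDerivWithinAt h1

/-- The values off the critical set are regular values of every branch. -/
theorem regular_of_notMem {N : ℕ} {lam : Fin N → Torus → ℝ} {j : Fin N} {p : ℝ}
    (h : lam j (p : Torus) ∉ criticalSet lam) :
    DifferentiableAt ℝ (fun q : ℝ => lam j (q : Torus)) p ∧
      deriv (fun q : ℝ => lam j (q : Torus)) p ≠ 0 := by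
  have h1 : ¬ (¬ DifferentiableAt ℝ (fun q : ℝ => lam j (q : Torus)) p ∨
      deriv (fun q : ℝ => lam j (q : Torus)) p = 0) := fun h2 =>
    h (mem_iUnion.2 ⟨j, p, rfl, h2⟩)
  rw [not_or, not_not] at h1
  exact h1

/-- A branch whose boundary value is not critical is differentiable across `p = π`. -/
theorem boundary_of_notMem {N : ℕ} {A : ℤ → Mat N} (hA : Summable fun m => opNorm (A m))
    {lam : Fin N → Torus → ℝ} {W : Fin N → Torus → Vec N}
    (hs : IsEigensystem (symbol A) lam W) {g : Fin N → ℝ → ℝ} (hg : ∀ j, ContDiff ℝ ∞ (g j))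
    (hlg : ∀ j, ∀ p ∈ Ioo (-π) π, lam j (p : Torus) = g j p) (j : Fin N)
    (h : g j π ∉ criticalSet lam ∨ g j (-π) ∉ criticalSet lam) :
    g j (-π) = g j π ∧ deriv (g j) (-π) = deriv (g j) π ∧ deriv (g j) π ≠ 0 := by
  have key : ∀ k, lam k (π : Torus) ∉ criticalSet lam → g k π = lam k (π : Torus) ∧
      g k (-π) = lam k (π : Torus) ∧ deriv (g k) (-π) = deriv (g k) π ∧ deriv (g k) π ≠ 0 := by
    intro k hk
    obtain ⟨hd, hne⟩ := regular_of_notMem hk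
    obtain ⟨h1, h2, h3, h4⟩ := boundary_of_differentiableAt (hg k) (hlg k) hd
    exact ⟨h1, h2, h4.trans h3.symm, h3 ▸ hne⟩
  suffices hl : lam j (π : Torus) ∉ criticalSet lam by
    obtain ⟨h1, h2, h3, h4⟩ := key j hl
    exact ⟨h2.trans h1.symm, h3, h4⟩
  rcases h with h | h
  · have hc := (card_boundary hA hs (fun k => (hg k).continuous) hlg (g j π)).1
    -- Every branch whose value at `π` is the noncritical number `g j π` is differentiable there, so
    -- its left limit is the same number. The inclusion is between sets of equal cardinality, hence
    -- an equality, and `j` lies in the right-hand set.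
    have hsub : (Finset.univ.filter fun k => lam k (π : Torus) = g j π)
        ⊆ Finset.univ.filter fun k => g k π = g j π := by
      intro k hk
      rw [Finset.mem_filter] at hk ⊢
      exact ⟨hk.1, (key k (by rw [hk.2]; exact h)).1.trans hk.2⟩
    have heq := Finset.eq_of_subset_of_card_le hsub hc.ge
    have hj : j ∈ Finset.univ.filter fun k => lam k (π : Torus) = g j π := by
      rw [heq]; simp
    rw [(Finset.mem_filter.1 hj).2]; exact h
  · have hc := (card_boundary hA hs (fun k => (hg k).continuous) hlg (g j (-π))).2
    have hsub : (Finset.univ.filter fun k => lam k (π : Torus) = g j (-π))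
        ⊆ Finset.univ.filter fun k => g k (-π) = g j (-π) := by
      intro k hk
      rw [Finset.mem_filter] at hk ⊢
      exact ⟨hk.1, (key k (by rw [hk.2]; exact h)).2.1.trans hk.2⟩
    have heq := Finset.eq_of_subset_of_card_le hsub hc.ge
    have hj : j ∈ Finset.univ.filter fun k => lam k (π : Torus) = g j (-π) := by
      rw [heq]; simp
    rw [(Finset.mem_filter.1 hj).2]; exact h

/-- Thus the field is `ζ(λ)/λ'`; with division by zero equal to zero, the identity also holds at
`0`. -/
theorem div_abs_sq (x : ℝ) : x / |x| ^ 2 = x⁻¹ := by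
  rw [sq_abs]
  rcases eq_or_ne x 0 with rfl | hx
  · simp
  · field_simp

/-- The field of a branch is regular. -/
theorem exists_isRegularField {N : ℕ} {A : ℤ → Mat N} (hA : Summable fun m => opNorm (A m))
    {lam : Fin N → Torus → ℝ} {W : Fin N → Torus → Vec N}
    (hs : IsEigensystem (symbol A) lam W) {ζ : ℝ → ℝ} (hζ : ContDiff ℝ ∞ ζ)
    (hcrit : Disjoint (tsupport ζ) (criticalSet lam)) (j : Fin N) :
    ∃ g Φ Φ' : ℝ → ℝ, IsRegularField (field ζ (lam j)) Φ Φ' ∧ ContDiff ℝ ∞ g ∧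
      (∀ p ∈ Ioo (-π) π, lam j (p : Torus) = g p) ∧ g (-π) * Φ (-π) = g π * Φ π ∧
      ∀ p ∈ Icc (-π) π, deriv g p * Φ p = ζ (g p) := by
  choose g hg hlg using fun k => (hs.regular_lam k).2
  have hnot : ∀ x, x ∈ tsupport ζ → x ∉ criticalSet lam := fun x hx =>
    Set.disjoint_left.1 hcrit hx
  have hbd := boundary_of_notMem hA hs hg hlg j
  have hderiv : ∀ p ∈ Ioo (-π) π,
      deriv (fun q : ℝ => lam j (q : Torus)) p = deriv (g j) p := fun p hp => by
    have : (fun q : ℝ => lam j (q : Torus)) =ᶠ[𝓝 p] g j := by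
      filter_upwards [isOpen_Ioo.mem_nhds hp] with q hq using hlg j q hq
    exact this.deriv_eq
  -- At an end point `g j p` is only a one-sided limit of the branch, so noncriticality of this
  -- number must pass through `boundary_of_notMem`.
  have hreg : ∀ p ∈ Icc (-π) π, g j p ∈ tsupport ζ → deriv (g j) p ≠ 0 := by
    intro p hp hmem
    have hn := hnot _ hmem
    rcases eq_or_lt_of_le hp.1 with h1 | h1
    · rw [← h1] at hn ⊢
      obtain ⟨-, h3, h4⟩ := hbd (Or.inr hn)
      rwa [h3]
    · rcases eq_or_lt_of_le hp.2 with h2 | h2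
      · rw [h2] at hn ⊢
        exact (hbd (Or.inl hn)).2.2
      · rw [← hderiv p ⟨h1, h2⟩]
        rw [← hlg j p ⟨h1, h2⟩] at hn
        exact (regular_of_notMem hn).2
  -- Using the smooth extension `g j` makes `Φ` smooth up to the end points. Where `deriv (g j)`
  -- vanishes, `ζ ∘ g j` vanishes in a neighbourhood.
  set Φ : ℝ → ℝ := fun p => ζ (g j p) * (deriv (g j) p)⁻¹ with hΦ
  have hg' : ContDiff ℝ ∞ (deriv (g j)) := (contDiff_infty_iff_deriv.1 (hg j)).2
  have hζg : ContDiff ℝ ∞ fun p => ζ (g j p) := hζ.comp (hg j)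
  have hsmooth : ∀ p ∈ Icc (-π) π, ContDiffAt ℝ ∞ Φ p := by
    intro p hp
    by_cases hmem : g j p ∈ tsupport ζ
    · exact hζg.contDiffAt.mul (hg'.contDiffAt.inv (hreg p hp hmem))
    · have h0 : ∀ᶠ q in 𝓝 p, Φ q = 0 := by
        have h1 : ∀ᶠ x in 𝓝 (g j p), ζ x = 0 := notMem_tsupport_iff_eventuallyEq.1 hmem
        filter_upwards [((hg j).continuous.tendsto p).eventually h1] with q hq
        simp only [hΦ, hq, zero_mul]
      exact contDiffAt_const.congr_of_eventuallyEq h0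
  have hboundary : Φ (-π) = Φ π ∧ g j (-π) * Φ (-π) = g j π * Φ π := by
    -- If one end value is in the support of `ζ`, the branch matches to first order across `π`;
    -- otherwise `Φ` is zero at both ends.
    by_cases h : g j π ∈ tsupport ζ ∨ g j (-π) ∈ tsupport ζ
    · obtain ⟨h1, h2, -⟩ := hbd (h.imp (hnot _) (hnot _))
      simp only [hΦ, h1, h2, and_self]
    · rw [not_or] at h
      simp only [hΦ, image_eq_zero_of_notMem_tsupport h.1, image_eq_zero_of_notMem_tsupport h.2,
        zero_mul, mul_zero, and_self]
  refine ⟨g j, Φ, deriv Φ, ⟨fun p hp => ?_, fun p hp => ?_, hboundary.1, fun p hp => ?_⟩,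
    hg j, hlg j, hboundary.2, fun p hp => ?_⟩
  · exact ((hsmooth p hp).differentiableAt (by simp)).hasDerivAt
  · have h1 : ContDiffAt ℝ 0 (fderiv ℝ Φ) p := (hsmooth p hp).fderiv_right (by simp)
    exact (h1.continuousAt.clm_apply continuousAt_const).continuousWithinAt
  · rw [field, div_abs_sq, hderiv p hp, hlg j p hp]
  · by_cases hmem : g j p ∈ tsupport ζ
    · have := hreg p hp hmem
      simp only [hΦ]
      field_simp
    · simp only [hΦ, image_eq_zero_of_notMem_tsupport hmem, zero_mul, mul_zero]

/-! ### Orthogonal decompositions -/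

theorem aeval_intertwine {E G : Type*} [NormedAddCommGroup E] [InnerProductSpace ℂ E]
    [NormedAddCommGroup G] [InnerProductSpace ℂ G] {D : E →L[ℂ] G} {S : E →L[ℂ] E} {T : G →L[ℂ] G}
    (hS : ∀ ψ, D (S ψ) = T (D ψ)) (p : Polynomial ℝ) (ψ : E) :
    D (Polynomial.aeval S p ψ) = Polynomial.aeval T p (D ψ) := by
  have hpow : ∀ (n : ℕ) (ψ : E), D ((S ^ n) ψ) = (T ^ n) (D ψ) := by
    intro n
    induction n with
    | zero => simp
    | succ n ih =>
      intro ψ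
      rw [pow_succ, mul_apply_eq_comp, ih, hS, pow_succ, mul_apply_eq_comp]
  induction p using Polynomial.induction_on' with
  | add p q hp hq => simp [hp, hq]
  | monomial n a =>
    rw [Polynomial.aeval_monomial, Polynomial.aeval_monomial, ← Algebra.smul_def,
      ← Algebra.smul_def]
    change D (a • (S ^ n) ψ) = a • (T ^ n) (D ψ)
    rw [← hpow, ← Complex.coe_smul, map_smul, Complex.coe_smul]

theorem aeval_eq_of_monomial {G : Type*} [NormedAddCommGroup G] [InnerProductSpace ℂ G]
    {T : G →L[ℂ] G} {M : Polynomial ℝ → G →L[ℂ] G} (hadd : ∀ p q, M (p + q) = M p + M q)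
    (hmon : ∀ n a, M (Polynomial.monomial n a) = (a : ℂ) • T ^ n) (p : Polynomial ℝ) :
    Polynomial.aeval T p = M p := by
  induction p using Polynomial.induction_on' with
  | add p q hp hq => rw [map_add, hp, hq, hadd]
  | monomial n a =>
    rw [Polynomial.aeval_monomial, ← Algebra.smul_def, hmon]
    ext1 x
    change a • (T ^ n) x = (a : ℂ) • (T ^ n) x
    rw [Complex.coe_smul]

section Decomposition

variable {E G : Type*} [NormedAddCommGroup E] [InnerProductSpace ℂ E] [CompleteSpace E]
  [NormedAddCommGroup G] [InnerProductSpace ℂ G] [CompleteSpace G] {ι : Type*} [Fintype ι]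

open Classical in
/-- The maps `D j` are the components of a unitary operator `E → ⨁_j G`. -/
structure IsDecomposition (D : ι → E →L[ℂ] G) : Prop where
  orthogonal : ∀ j k u, D j (ContinuousLinearMap.adjoint (D k) u) = if j = k then u else 0
  complete : ∀ ψ, ∑ j, ContinuousLinearMap.adjoint (D j) (D j ψ) = ψ

/-- The direct sum of the operators `T j`, transported to `E`. -/
noncomputable def directSumOp (D : ι → E →L[ℂ] G) (T : ι → G →L[ℂ] G) : E →L[ℂ] E :=
  ∑ j, (ContinuousLinearMap.adjoint (D j)).comp ((T j).comp (D j))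

theorem directSumOp_apply (D : ι → E →L[ℂ] G) (T : ι → G →L[ℂ] G) (ψ : E) :
    directSumOp D T ψ = ∑ j, ContinuousLinearMap.adjoint (D j) (T j (D j ψ)) := by
  simp [directSumOp]

theorem isSelfAdjoint_directSumOp (D : ι → E →L[ℂ] G) {T : ι → G →L[ℂ] G}
    (hT : ∀ j, IsSelfAdjoint (T j)) : IsSelfAdjoint (directSumOp D T) := by
  rw [ContinuousLinearMap.isSelfAdjoint_iff', directSumOp, map_sum]
  refine Finset.sum_congr rfl fun j _ => ?_
  rw [ContinuousLinearMap.adjoint_comp, ContinuousLinearMap.adjoint_comp,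
    ContinuousLinearMap.adjoint_adjoint, (hT j).adjoint_eq, ContinuousLinearMap.comp_assoc]

namespace IsDecomposition

variable {D : ι → E →L[ℂ] G} (h : IsDecomposition D)

include h

theorem apply_sum (j : ι) (u : ι → G) :
    D j (∑ k, ContinuousLinearMap.adjoint (D k) (u k)) = u j := by
  classical
  simp [map_sum, h.orthogonal]

theorem apply_directSumOp (T : ι → G →L[ℂ] G) (j : ι) (ψ : E) :
    D j (directSumOp D T ψ) = T j (D j ψ) := by
  rw [directSumOp_apply, h.apply_sum j fun k => T k (D k ψ)]

theorem inner_eq (ψ η : E) : inner ℂ ψ η = ∑ j, inner ℂ (D j ψ) (D j η) := by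
  conv_lhs => rw [← h.complete η, inner_sum]
  exact Finset.sum_congr rfl fun j _ => ContinuousLinearMap.adjoint_inner_right _ _ _

theorem norm_sq_eq (ψ : E) : ‖ψ‖ ^ 2 = ∑ j, ‖D j ψ‖ ^ 2 := by
  have h1 := h.inner_eq ψ ψ
  simp only [inner_self_eq_norm_sq_to_K] at h1
  exact_mod_cast h1

theorem ext {ψ η : E} (hj : ∀ j, D j ψ = D j η) : ψ = η := by
  rw [← h.complete ψ, ← h.complete η]
  simp only [hj]

theorem eq_directSumOp {S : E →L[ℂ] E} {T : ι → G →L[ℂ] G}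
    (hS : ∀ j ψ, D j (S ψ) = T j (D j ψ)) : S = directSumOp D T := by
  ext1 ψ
  exact h.ext fun j => by rw [hS, h.apply_directSumOp]

theorem norm_directSumOp_le {T : ι → G →L[ℂ] G} {δ : ℝ} (hδ : 0 ≤ δ) (hT : ∀ j, ‖T j‖ ≤ δ) :
    ‖directSumOp D T‖ ≤ δ := by
  refine ContinuousLinearMap.opNorm_le_bound _ hδ fun ψ => ?_
  refine le_of_sq_le_sq ?_ (by positivity)
  rw [h.norm_sq_eq, mul_pow, h.norm_sq_eq ψ, Finset.mul_sum]
  refine Finset.sum_le_sum fun j _ => ?_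
  rw [h.apply_directSumOp, ← mul_pow]
  gcongr
  exact (T j).le_of_opNorm_le (hT j) _

theorem isFunctionOf_directSumOp {S : E →L[ℂ] E} {T Z : ι → G →L[ℂ] G} {ζ : ℝ → ℝ} {R : ℝ}
    (hS : ∀ j ψ, D j (S ψ) = T j (D j ψ)) (hZ : ∀ j, IsFunctionOf (Z j) (T j) ζ R) :
    IsFunctionOf (directSumOp D Z) S ζ R := by
  intro p δ hδ hp
  have e : Polynomial.aeval S p - directSumOp D Z
      = directSumOp D fun j => Polynomial.aeval (T j) p - Z j := by
    refine h.eq_directSumOp fun j ψ => ?_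
    rw [sub_apply, map_sub, aeval_intertwine (hS j), h.apply_directSumOp, ← sub_apply]
  rw [e]
  exact h.norm_directSumOp_le hδ fun j => hZ j p δ hδ hp

/-- The graphs of a direct sum: if the summands are self-adjoint, so is the sum. -/
theorem adjoint_graph_eq {g : ι → Submodule ℂ (G × G)} (hg : ∀ j, (g j).adjoint = g j)
    {A : Submodule ℂ (E × E)} (hA : ∀ x, x ∈ A ↔ ∀ j, (D j x.1, D j x.2) ∈ g j) :
    A.adjoint = A := by
  classical
  ext ⟨u, w⟩
  rw [Submodule.mem_adjoint_iff]
  constructor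
  · intro hx
    rw [hA]
    intro j
    rw [← hg j, Submodule.mem_adjoint_iff]
    intro a c hac
    -- Test pairs concentrated in the `j`-th summand isolate the `j`-th condition.
    have hmem : (ContinuousLinearMap.adjoint (D j) a, ContinuousLinearMap.adjoint (D j) c) ∈ A := by
      rw [hA]
      intro k
      simp only [h.orthogonal]
      split_ifs with hkj
      · rwa [hkj]
      · exact (g k).zero_mem
    have := hx _ _ hmem
    rwa [ContinuousLinearMap.adjoint_inner_left, ContinuousLinearMap.adjoint_inner_left] at this
  · intro hx a c hac
    rw [hA] at hx hac
    rw [h.inner_eq, h.inner_eq, ← Finset.sum_sub_distrib]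
    refine Finset.sum_eq_zero fun j _ => ?_
    have h1 := hx j
    rw [← hg j, Submodule.mem_adjoint_iff] at h1
    exact h1 _ _ (hac j)

theorem dense_domain {g : ι → Submodule ℂ (G × G)}
    (hg : ∀ j, Dense ((g j).map (LinearMap.fst ℂ G G) : Set G))
    {A : Submodule ℂ (E × E)} (hA : ∀ x, x ∈ A ↔ ∀ j, (D j x.1, D j x.2) ∈ g j) :
    Dense (A.map (LinearMap.fst ℂ E E) : Set E) := by
  intro ψ
  have hcont : Continuous fun u : ι → G => ∑ k, ContinuousLinearMap.adjoint (D k) (u k) :=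
    continuous_finsetSum _ fun k _ =>
      (ContinuousLinearMap.adjoint (D k)).continuous.comp (continuous_apply k)
  have hd : Dense (Set.pi univ fun j => ((g j).map (LinearMap.fst ℂ G G) : Set G)) :=
    dense_pi univ fun j _ => hg j
  have h1 := hcont.range_subset_closure_image_dense hd ⟨fun j => D j ψ, rfl⟩
  simp only [h.complete] at h1
  refine closure_mono ?_ h1
  rintro _ ⟨u, hu, rfl⟩
  have hex : ∀ j, ∃ v, (u j, v) ∈ g j := fun j => by
    obtain ⟨x, hx, hxu⟩ := hu j (mem_univ j)
    exact ⟨x.2, by rw [← hxu]; exact hx⟩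
  choose v hv using hex
  refine ⟨(∑ k, ContinuousLinearMap.adjoint (D k) (u k),
    ∑ k, ContinuousLinearMap.adjoint (D k) (v k)), ?_, rfl⟩
  refine (hA _).2 fun j => ?_
  simp only [h.apply_sum]
  exact hv j

end IsDecomposition

end Decomposition

/-! ### The Fourier transform and the diagonalization -/

theorem component_add {N : ℕ} (a : Fin N) (ψ η : Seq N) :
    component a (ψ + η) = component a ψ + component a η := rfl

theorem norm_component_le {N : ℕ} (a : Fin N) (ψ : Seq N) : ‖component a ψ‖ ≤ ‖ψ‖ :=
  lp.norm_mono (by norm_num) fun n => PiLp.norm_apply_le (ψ n) a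

/-- The Fourier series with coefficients `(ψ_n)_a`. -/
noncomputable def fourierComponent {N : ℕ} (a : Fin N) : Seq N →L[ℂ] L2T :=
  LinearMap.mkContinuous
    { toFun := fun ψ => fourierBasis.repr.symm (component a ψ)
      map_add' := fun ψ η => by rw [component_add, map_add]
      map_smul' := fun c ψ => by
        rw [show component a (c • ψ) = c • component a ψ from rfl, map_smul]; rfl }
    1 (fun ψ => by
      rw [one_mul]
      exact (fourierBasis.repr.symm.norm_map _).le.trans (norm_component_le a ψ))

theorem fourierComponent_apply {N : ℕ} (a : Fin N) (ψ : Seq N) :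
    fourierComponent a ψ = fourierBasis.repr.symm (component a ψ) := rfl

theorem sum_inner_fourierComponent {N : ℕ} (ψ η : Seq N) :
    ∑ a, inner ℂ (fourierComponent a ψ) (fourierComponent a η) = inner ℂ ψ η := by
  have h1 : ∀ a, HasSum (fun n => inner ℂ (ψ n a) (η n a))
      (inner ℂ (fourierComponent a ψ) (fourierComponent a η)) := fun a => by
    rw [fourierComponent_apply, fourierComponent_apply, LinearIsometryEquiv.inner_map_map]
    exact lp.hasSum_inner (component a ψ) (component a η)
  have h2 := hasSum_sum fun a (_ : a ∈ Finset.univ) => h1 a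
  refine h2.unique ?_
  simp only [← PiLp.inner_apply]
  exact lp.hasSum_inner ψ η

theorem sum_adjoint_fourierComponent {N : ℕ} (ψ : Seq N) :
    ∑ a, ContinuousLinearMap.adjoint (fourierComponent a) (fourierComponent a ψ) = ψ := by
  refine ext_inner_left ℂ fun η => ?_
  rw [inner_sum, ← sum_inner_fourierComponent η ψ]
  exact Finset.sum_congr rfl fun a _ => ContinuousLinearMap.adjoint_inner_right _ _ _

theorem exists_fourierComponent_eq {N : ℕ} (v : Fin N → L2T) :
    ∃ ψ : Seq N, ∀ a, fourierComponent a ψ = v a := by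
  have hmem : Memℓp (fun n : ℤ => (WithLp.toLp 2 fun a => fourierBasis.repr (v a) n : Vec N)) 2 := by
    refine memℓp_gen ?_
    have h1 : ∀ a, Summable fun n : ℤ => ‖fourierBasis.repr (v a) n‖ ^ (2 : ℝ) := fun a => by
      simpa using (lp.memℓp (fourierBasis.repr (v a))).summable (by norm_num)
    refine (summable_sum fun a (_ : a ∈ Finset.univ) => h1 a).congr fun n => ?_
    rw [ENNReal.toReal_ofNat, Real.rpow_two, EuclideanSpace.norm_sq_eq]
    simp
  refine ⟨⟨_, hmem⟩, fun a => ?_⟩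
  rw [fourierComponent_apply, LinearIsometryEquiv.symm_apply_eq]
  rfl

/-- By surjectivity there is a sequence whose only nonzero component transform is `u` in place `b`;
Parseval identifies it with the adjoint image. -/
theorem fourierComponent_adjoint {N : ℕ} (a b : Fin N) (u : L2T) :
    fourierComponent a (ContinuousLinearMap.adjoint (fourierComponent b) u)
      = if a = b then u else 0 := by
  obtain ⟨ψ, hψ⟩ := exists_fourierComponent_eq fun c : Fin N => if c = b then u else 0
  have : ContinuousLinearMap.adjoint (fourierComponent b) u = ψ := by
    refine ext_inner_left ℂ fun η => ?_
    rw [ContinuousLinearMap.adjoint_inner_right, ← sum_inner_fourierComponent]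
    rw [Finset.sum_eq_single b (fun a _ hab => by rw [hψ, if_neg hab, inner_zero_right])
      (fun hb => absurd (Finset.mem_univ b) hb), hψ, if_pos rfl]
  rw [this, hψ]

theorem memLp_continuousMap (f : C(Torus, ℂ)) : MemLp f ∞ haarT :=
  memLp_top_of_bound f.continuous.aestronglyMeasurable ‖f‖
    (Eventually.of_forall f.norm_coe_le_norm)

/-- Multiplication by a continuous function, as a bounded linear map. -/
noncomputable def contMulOp : C(Torus, ℂ) →L[ℂ] (L2T →L[ℂ] L2T) :=
  LinearMap.mkContinuous
    { toFun := fun f => mulOp f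
      map_add' := fun f g => (mulOp_add (memLp_continuousMap f) (memLp_continuousMap g)).symm
      map_smul' := fun c f => (mulOp_smul (memLp_continuousMap f) c).symm }
    1 (fun f => by
      rw [one_mul]
      exact norm_mulOp_le (norm_nonneg f) (Eventually.of_forall f.norm_coe_le_norm))

theorem contMulOp_apply (f : C(Torus, ℂ)) : contMulOp f = mulOp f := rfl

/-- Translation by `m` becomes multiplication by `e^{imp}`. -/
theorem fourierComponent_blockShift {N : ℕ} (m : ℤ) (B : Mat N) (ψ : Seq N) (a : Fin N) :
    fourierComponent a (blockShift m B ψ)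
      = ∑ b, B a b • mulOp (fourier m) (fourierComponent b ψ) := by
  refine hilbertBasis_ext fourierBasis fun k => ?_
  have h1 : ∀ (c : Fin N) (η : Seq N) (n : ℤ),
      inner ℂ (fourierBasis n : L2T) (fourierComponent c η) = η n c := fun c η n => by
    rw [← fourierBasis.repr_apply_apply, fourierComponent_apply,
      LinearIsometryEquiv.apply_symm_apply]
    rfl
  have h2 : ∀ u : L2T, inner ℂ (fourierBasis k : L2T) (mulOp (fourier m) u)
      = inner ℂ (fourierBasis (k - m) : L2T) u := fun u => by
    rw [inner_fourierBasis, inner_fourierBasis, fourierCoeff, fourierCoeff]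
    refine integral_congr_ae ?_
    filter_upwards [coeFn_mulOp (memLp_continuousMap (fourier m)) u] with x hx
    rw [hx, show -(k - m) = -k + m by ring, fourier_add, smul_eq_mul, smul_eq_mul]
    ring
  rw [h1, blockShift_apply, toEuclideanCLM_apply, inner_sum]
  simp only [inner_smul_right, h2, h1]

/-- Summability makes the entries of the symbol converge uniformly, and `contMulOp` carries this to
norm convergence of the multiplications. -/
theorem fourierComponent_laurent {N : ℕ} {A : ℤ → Mat N} (hA : Summable fun m => opNorm (A m))
    (ψ : Seq N) (a : Fin N) : fourierComponent a (laurent A ψ)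
      = ∑ b, mulOp (fun p => symbol A p a b) (fourierComponent b ψ) := by
  have hs : Summable fun m => blockShift m (A m) :=
    Summable.of_norm_bounded hA fun m => norm_blockShift_le m (A m)
  have h1 : HasSum (fun m => fourierComponent a (blockShift m (A m) ψ))
      (fourierComponent a (laurent A ψ)) :=
    (hs.hasSum.mapL (ContinuousLinearMap.apply ℂ (Seq N) ψ)).mapL (fourierComponent a)
  refine h1.unique ?_
  simp only [fourierComponent_blockShift, symbol_apply hA]
  refine hasSum_sum fun b _ => ?_
  have h2 := ((hasSum_symbolEntry hA a b).mapL contMulOp).mapL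
    (ContinuousLinearMap.apply ℂ L2T (fourierComponent b ψ))
  simpa [contMulOp_apply] using h2

/-! ### Regularity of the eigenvalues and eigenvectors -/

section Eigensystem

variable {N : ℕ} {h : Torus → Mat N} {lam : Fin N → Torus → ℝ} {W : Fin N → Torus → Vec N}

theorem memLp_eigenvector (hs : IsEigensystem h lam W) (j a : Fin N) :
    MemLp (fun p => W j p a) ∞ haarT := by
  refine memLp_torus (C := 1) ?_ (fun p _ => ?_) _
  · exact (PiLp.continuous_apply 2 (fun _ : Fin N => ℂ) a).comp_continuousOn
      (hs.regular_W j).1.continuousOn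
  · exact (PiLp.norm_apply_le _ a).trans ((hs.orthonormal _).1 j).le

theorem exists_bound_eigenvalue (hs : IsEigensystem h lam W) (j : Fin N) :
    ∃ C, ∀ p ∈ Ioo (-π) π, |lam j ((p : ℝ) : Torus)| ≤ C := by
  obtain ⟨g, hg, hlg⟩ := (hs.regular_lam j).2
  obtain ⟨C, hC⟩ := isCompact_Icc.exists_bound_of_continuousOn
    (hg.continuous.continuousOn (s := Icc (-π) π))
  exact ⟨C, fun p hp => by rw [hlg p hp]; exact hC p (Ioo_subset_Icc_self hp)⟩

theorem memLp_comp_eigenvalue (hs : IsEigensystem h lam W) (j : Fin N) {f : ℝ → ℝ}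
    (hf : Continuous f) : MemLp (fun p => (f (lam j p) : ℂ)) ∞ haarT := by
  obtain ⟨C, hC⟩ := exists_bound_eigenvalue hs j
  obtain ⟨K, hK⟩ := isCompact_Icc.exists_bound_of_continuousOn
    (hf.continuousOn (s := Icc (-C) C))
  refine memLp_torus (C := K) ?_ (fun p hp => ?_) _
  · exact Complex.continuous_ofReal.comp_continuousOn
      (hf.comp_continuousOn (hs.regular_lam j).1.continuousOn)
  · rw [Complex.norm_real]; exact hK _ (abs_le.1 (hC p hp))

/-- The operator of multiplication by `f(λ_j)`. -/
noncomputable def eigenMulOp (lam : Fin N → Torus → ℝ) (f : ℝ → ℝ) (j : Fin N) : L2T →L[ℂ] L2T :=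
  mulOp fun p => (f (lam j p) : ℂ)

/-- The components of the unitary operator `𝓤`. -/
noncomputable def diagComponent (W : Fin N → Torus → Vec N) (j : Fin N) : Seq N →L[ℂ] L2T :=
  ∑ a, (mulOp fun p => (starRingEnd ℂ) (W j p a)).comp (fourierComponent a)

theorem diagComponent_apply (W : Fin N → Torus → Vec N) (j : Fin N) (ψ : Seq N) :
    diagComponent W j ψ
      = ∑ a, mulOp (fun p => (starRingEnd ℂ) (W j p a)) (fourierComponent a ψ) := by
  simp [diagComponent]

theorem memLp_conj {f : Torus → ℂ} (hf : MemLp f ∞ haarT) :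
    MemLp (fun x => (starRingEnd ℂ) (f x)) ∞ haarT := hf.star

theorem memLp_mul {f g : Torus → ℂ} (hf : MemLp f ∞ haarT) (hg : MemLp g ∞ haarT) :
    MemLp (fun x => f x * g x) ∞ haarT := hg.mul hf

theorem coeFn_finset_sum {ι : Type*} (s : Finset ι) (f : ι → L2T) :
    ((∑ i ∈ s, f i : L2T) : Torus → ℂ) =ᵐ[haarT] fun x => ∑ i ∈ s, f i x := by
  classical
  induction s using Finset.induction_on with
  | empty =>
    simp only [Finset.sum_empty]
    exact Lp.coeFn_zero ℂ 2 haarT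
  | insert i s hi ih =>
    rw [Finset.sum_insert hi]
    filter_upwards [Lp.coeFn_add (f i) (∑ k ∈ s, f k), ih] with x h1 h2
    rw [h1, Pi.add_apply, h2, Finset.sum_insert hi]

theorem coeFn_diagComponent (hs : IsEigensystem h lam W) (j : Fin N) (ψ : Seq N) :
    diagComponent W j ψ =ᵐ[haarT] diagonalize W j ψ := by
  rw [diagComponent_apply]
  have h1 : ∀ a, mulOp (fun p => (starRingEnd ℂ) (W j p a)) (fourierComponent a ψ)
      =ᵐ[haarT] fun p => (starRingEnd ℂ) (W j p a) * fourierComponent a ψ p := fun a =>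
    coeFn_mulOp (memLp_conj (memLp_eigenvector hs j a)) _
  filter_upwards [coeFn_finset_sum Finset.univ fun a =>
    mulOp (fun p => (starRingEnd ℂ) (W j p a)) (fourierComponent a ψ), ae_all_iff.2 h1] with p h2 h3
  rw [h2, diagonalize, PiLp.inner_apply]
  refine Finset.sum_congr rfl fun a _ => ?_
  rw [h3 a, RCLike.inner_apply, mul_comm]
  rfl

theorem adjoint_diagComponent_apply (hs : IsEigensystem h lam W) (j : Fin N) (u : L2T) :
    ContinuousLinearMap.adjoint (diagComponent W j) u
      = ∑ a, ContinuousLinearMap.adjoint (fourierComponent a) (mulOp (fun p => W j p a) u) := by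
  rw [diagComponent, map_sum, _root_.sum_apply]
  refine Finset.sum_congr rfl fun a _ => ?_
  rw [ContinuousLinearMap.adjoint_comp, ContinuousLinearMap.comp_apply,
    adjoint_mulOp (memLp_conj (memLp_eigenvector hs j a))]
  simp only [Complex.conj_conj]

theorem mulOp_apply_mulOp {f g : Torus → ℂ} (hf : MemLp f ∞ haarT) (hg : MemLp g ∞ haarT)
    (u : L2T) : mulOp f (mulOp g u) = mulOp (fun p => f p * g p) u := by
  rw [← mulOp_mul hf hg, mul_apply_eq_comp]

theorem sum_mulOp_apply {ι : Type*} (s : Finset ι) {f : ι → Torus → ℂ}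
    (hf : ∀ i ∈ s, MemLp (f i) ∞ haarT) (u : L2T) :
    ∑ i ∈ s, mulOp (f i) u = mulOp (fun x => ∑ i ∈ s, f i x) u := by
  rw [← mulOp_sum s hf, _root_.sum_apply]

/-- Orthogonality is `W*W = 1` pointwise, completeness is `WW* = 1`; the two are equivalent for
square matrices. -/
theorem isDecomposition_diagComponent (hs : IsEigensystem h lam W) :
    IsDecomposition (diagComponent W) := by
  have hW := memLp_eigenvector hs
  have hW' : ∀ j a, MemLp (fun p => (starRingEnd ℂ) (W j p a)) ∞ haarT := fun j a => memLp_conj (hW j a)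
  constructor
  · intro j k u
    rw [diagComponent_apply]
    have h1 : ∀ a, fourierComponent a (ContinuousLinearMap.adjoint (diagComponent W k) u)
        = mulOp (fun p => W k p a) u := fun a => by
      rw [adjoint_diagComponent_apply hs, map_sum]
      simp only [fourierComponent_adjoint]
      simp
    simp only [h1, mulOp_apply_mulOp (hW' j _) (hW k _)]
    rw [sum_mulOp_apply _ fun a _ => memLp_mul (hW' j a) (hW k a)]
    have h2 : (fun p => ∑ a, (starRingEnd ℂ) (W j p a) * W k p a)
        = fun _ => if j = k then 1 else 0 := by
      funext p
      rw [← orthonormal_iff_ite.1 (hs.orthonormal p) j k, PiLp.inner_apply]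
      simp [mul_comm]
    rw [h2, mulOp_const]
    split_ifs <;> simp
  · intro ψ
    have h1 : ∀ j, ContinuousLinearMap.adjoint (diagComponent W j) (diagComponent W j ψ)
        = ∑ b, ∑ a, ContinuousLinearMap.adjoint (fourierComponent b)
          (mulOp (fun p => W j p b * (starRingEnd ℂ) (W j p a)) (fourierComponent a ψ)) := by
      intro j
      rw [adjoint_diagComponent_apply hs, diagComponent_apply]
      simp only [map_sum, mulOp_apply_mulOp (hW j _) (hW' j _)]
    have h2 : ∀ a b : Fin N, (fun p => ∑ j, W j p b * (starRingEnd ℂ) (W j p a))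
        = fun _ => if b = a then 1 else 0 := by
      intro a b
      funext p
      have := mul_eq_one_comm.1 (eigenMatrix_conjTranspose_mul (hs.orthonormal p))
      have := congrFun (congrFun this b) a
      rw [Matrix.mul_apply, Matrix.one_apply] at this
      exact this
    simp only [h1]
    rw [Finset.sum_comm]
    conv_rhs => rw [← sum_adjoint_fourierComponent ψ]
    refine Finset.sum_congr rfl fun b _ => ?_
    rw [Finset.sum_comm]
    have h3 : ∀ a, ∑ j, ContinuousLinearMap.adjoint (fourierComponent b)
        (mulOp (fun p => W j p b * (starRingEnd ℂ) (W j p a)) (fourierComponent a ψ))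
        = if b = a then ContinuousLinearMap.adjoint (fourierComponent b) (fourierComponent a ψ)
          else 0 := by
      intro a
      rw [← map_sum, sum_mulOp_apply _ fun j _ => memLp_mul (hW j b) (hW' j a), h2, mulOp_const]
      split_ifs <;> simp
    simp only [h3, Finset.sum_ite_eq, Finset.mem_univ, if_true]

/-- The rows of `W*` are left eigenvectors: `W*h = W*(hW)W* = ΛW*`, with `Λ` diagonal. -/
theorem sum_conj_eigenvector_mul (hs : IsEigensystem h lam W) (p : Torus) (j b : Fin N) :
    ∑ a, (starRingEnd ℂ) (W j p a) * h p a b = (lam j p : ℂ) * (starRingEnd ℂ) (W j p b) := by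
  have h1 := eigenMatrix_conjTranspose_mul (hs.orthonormal p)
  have h2 := mul_eq_one_comm.1 h1
  have h3 : h p * eigenMatrix W p
      = eigenMatrix W p * Matrix.diagonal fun j => (lam j p : ℂ) := by
    ext a j
    have he := congrArg (fun v : Vec N => v a) (hs.eigen p j)
    simp only [toEuclideanCLM_apply, PiLp.smul_apply, smul_eq_mul] at he
    rw [Matrix.mul_diagonal, Matrix.mul_apply]
    simp only [eigenMatrix, Matrix.of_apply, he]
    ring
  have h4 : (eigenMatrix W p).conjTranspose * h p
      = Matrix.diagonal (fun j => (lam j p : ℂ)) * (eigenMatrix W p).conjTranspose := by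
    calc _ = (eigenMatrix W p).conjTranspose * (h p * eigenMatrix W p)
          * (eigenMatrix W p).conjTranspose := by
          rw [Matrix.mul_assoc, Matrix.mul_assoc, h2, Matrix.mul_one]
      _ = _ := by rw [h3, ← Matrix.mul_assoc, h1, Matrix.one_mul]
  have h5 := congrFun (congrFun h4 j) b
  rw [Matrix.diagonal_mul, Matrix.mul_apply] at h5
  exact h5

end Eigensystem

theorem diagComponent_laurent {N : ℕ} {A : ℤ → Mat N} (hA : Summable fun m => opNorm (A m))
    {lam : Fin N → Torus → ℝ} {W : Fin N → Torus → Vec N}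
    (hs : IsEigensystem (symbol A) lam W) (j : Fin N) (ψ : Seq N) :
    diagComponent W j (laurent A ψ) = eigenMulOp lam id j (diagComponent W j ψ) := by
  have hW' : ∀ j a, MemLp (fun p => (starRingEnd ℂ) (W j p a)) ∞ haarT := fun j a =>
    memLp_conj (memLp_eigenvector hs j a)
  have hl : MemLp (fun p => ((id (lam j p) : ℝ) : ℂ)) ∞ haarT := memLp_comp_eigenvalue hs j continuous_id
  have hh : ∀ a b, MemLp (fun p => symbol A p a b) ∞ haarT := fun a b => by
    simp only [symbol_apply hA]
    exact memLp_continuousMap (symbolEntry A a b)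
  have e : ∀ a b, mulOp (fun p => (starRingEnd ℂ) (W j p a))
      (mulOp (fun p => symbol A p a b) (fourierComponent b ψ))
      = mulOp (fun p => (starRingEnd ℂ) (W j p a) * symbol A p a b) (fourierComponent b ψ) :=
    fun a b => mulOp_apply_mulOp (hW' j a) (hh a b) _
  have e2 : ∀ b, ∑ a, mulOp (fun p => (starRingEnd ℂ) (W j p a) * symbol A p a b)
      (fourierComponent b ψ) = eigenMulOp lam id j
        (mulOp (fun p => (starRingEnd ℂ) (W j p b)) (fourierComponent b ψ)) := by
    intro b
    rw [sum_mulOp_apply _ fun a _ => memLp_mul (hW' j a) (hh a b), eigenMulOp,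
      mulOp_apply_mulOp hl (hW' j b)]
    congr 2
    funext p
    exact sum_conj_eigenvector_mul hs p j b
  calc diagComponent W j (laurent A ψ)
      = ∑ a, ∑ b, mulOp (fun p => (starRingEnd ℂ) (W j p a) * symbol A p a b)
          (fourierComponent b ψ) := by
        rw [diagComponent_apply]
        refine Finset.sum_congr rfl fun a _ => ?_
        rw [fourierComponent_laurent hA, map_sum]
        exact Finset.sum_congr rfl fun b _ => e a b
    _ = ∑ b, eigenMulOp lam id j
          (mulOp (fun p => (starRingEnd ℂ) (W j p b)) (fourierComponent b ψ)) := by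
        rw [Finset.sum_comm]
        exact Finset.sum_congr rfl fun b _ => e2 b
    _ = _ := by rw [diagComponent_apply, map_sum]

/-! ### The conjugate operator and its commutator with the Laurent operator -/

section Conjugate

variable {N : ℕ} {A : ℤ → Mat N} {lam : Fin N → Torus → ℝ} {W : Fin N → Torus → Vec N}
  {ζ : ℝ → ℝ}

theorem mem_conjugateGraph_iff (hs : IsEigensystem (symbol A) lam W) (x : Seq N × Seq N) :
    x ∈ conjugateGraph lam W ζ ↔
      ∀ j, (diagComponent W j x.1, diagComponent W j x.2) ∈ (branchOp (field ζ (lam j))).graph := by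
  refine forall_congr' fun j => ?_
  constructor
  · rintro ⟨y, hy, h1, h2⟩
    have e1 : y.1 = diagComponent W j x.1 := Lp.ext (h1.trans (coeFn_diagComponent hs j _).symm)
    have e2 : y.2 = diagComponent W j x.2 := Lp.ext (h2.trans (coeFn_diagComponent hs j _).symm)
    rw [← e1, ← e2]
    exact hy
  · intro h
    exact ⟨_, h, coeFn_diagComponent hs j _, coeFn_diagComponent hs j _⟩

theorem graph_conjugateOp (hs : IsEigensystem (symbol A) lam W) :
    (conjugateOp lam W ζ).graph = conjugateGraph lam W ζ := by
  refine Submodule.toLinearPMap_graph_eq _ fun x hx h0 => ?_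
  rw [mem_conjugateGraph_iff hs] at hx
  refine (isDecomposition_diagComponent hs).ext fun j => ?_
  rw [map_zero]
  exact LinearPMap.graph_fst_eq_zero_snd _ (hx j) (by rw [h0, map_zero])

theorem isSelfAdjoint_conjugateOp (hA : Summable fun m => opNorm (A m))
    (hs : IsEigensystem (symbol A) lam W) (hζ : ContDiff ℝ ∞ ζ)
    (hcrit : Disjoint (tsupport ζ) (criticalSet lam)) :
    IsSelfAdjoint (conjugateOp lam W ζ) := by
  have hdec := isDecomposition_diagComponent hs
  choose g Φ Φ' hreg hg hlg hbd hΦ using exists_isRegularField hA hs hζ hcrit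
  refine isSelfAdjoint_of_adjoint_graph_eq ?_ ?_
  · refine hdec.dense_domain (g := fun j => (branchOp (field ζ (lam j))).graph) (fun j => ?_)
      (mem_conjugateGraph_iff hs)
    rw [LinearPMap.graph_map_fst_eq_domain]
    exact (hreg j).dense_domain_branchOp
  · rw [graph_conjugateOp hs]
    exact hdec.adjoint_graph_eq (fun j => (hreg j).adjoint_graph_branchOp)
      (mem_conjugateGraph_iff hs)

/-- The content is `(λF)' = ζ(λ) + λF'`, read off from Fourier coefficients. The product `λF` also
has equal end values, so its derivative has no boundary contribution. -/
theorem branch_commutator (hA : Summable fun m => opNorm (A m))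
    (hs : IsEigensystem (symbol A) lam W) (hζ : ContDiff ℝ ∞ ζ)
    (hcrit : Disjoint (tsupport ζ) (criticalSet lam)) (j : Fin N) {x y : L2T × L2T}
    (hx : x ∈ (branchOp (field ζ (lam j))).graph) (hy : y ∈ (branchOp (field ζ (lam j))).graph) :
    inner ℂ x.1 (eigenMulOp lam ζ j y.1)
      = Complex.I * (inner ℂ x.1 (eigenMulOp lam id j y.2)
        - inner ℂ x.2 (eigenMulOp lam id j y.1)) := by
  obtain ⟨g, Φ, Φ', hreg, hg, hlg, hbd, hΦ⟩ := exists_isRegularField hA hs hζ hcrit j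
  rw [hreg.graph_branchOp] at hx hy
  have hl : MemLp (fun p => ((id (lam j p) : ℝ) : ℂ)) ∞ haarT :=
    memLp_comp_eigenvalue hs j continuous_id
  have hz : MemLp (fun p => (ζ (lam j p) : ℂ)) ∞ haarT :=
    memLp_comp_eigenvalue hs j hζ.continuous
  refine closure_trigGraph_commutator (IsRegularField.isSelfAdjoint_onCircle hreg.memLp)
    (IsRegularField.isSelfAdjoint_onCircle hreg.memLp_deriv) (mulOp_comm hreg.memLp hl)
    (mulOp_comm hreg.memLp_deriv hl) ?_ hx hy
  simp only [eigenMulOp]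
  rw [mulOp_mul hl hreg.memLp, mulOp_mul hl hreg.memLp_deriv,
    mulOp_add hz (memLp_mul hl hreg.memLp_deriv)]
  refine isMatrixDeriv_mulOp (memLp_mul hl hreg.memLp)
    (hz.add (memLp_mul hl hreg.memLp_deriv)) fun n => ?_
  have hgd : ∀ p, HasDerivAt g (deriv g p) p := fun p =>
    (hg.differentiable (by simp) p).hasDerivAt
  refine fourierCoeff_deriv (Φ := fun p => ((g p * Φ p : ℝ) : ℂ))
    (Φ' := fun p => ((ζ (g p) + g p * Φ' p : ℝ) : ℂ)) (fun p hp => ?_) ?_ (by rw [hbd]) ?_ ?_ n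
  · rw [← hΦ p hp]
    exact ((hgd p).mul (hreg.hasDerivAt p hp)).ofReal_comp
  · exact Complex.continuous_ofReal.comp_continuousOn
      ((hζ.continuous.comp hg.continuous).continuousOn.add
        (hg.continuous.continuousOn.mul hreg.continuousOn))
  · intro p hp
    rw [onCircle_coe _ (Ioo_subset_Ioc_self hp), hlg p hp, hreg.eq p hp]
    push_cast
    rfl
  · intro p hp
    rw [onCircle_coe _ (Ioo_subset_Ioc_self hp), hlg p hp, hreg.deriv_eq hp]
    push_cast
    rfl

/-- `[H₀, i𝔸] = ζ(H₀)`. -/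
theorem isCommutator_laurent (hA : Summable fun m => opNorm (A m))
    (hs : IsEigensystem (symbol A) lam W) (hζ : ContDiff ℝ ∞ ζ)
    (hcrit : Disjoint (tsupport ζ) (criticalSet lam)) :
    IsCommutator (conjugateOp lam W ζ) (laurent A)
      (directSumOp (diagComponent W) (eigenMulOp lam ζ)) := by
  have hdec := isDecomposition_diagComponent hs
  rw [isCommutator_iff_graph]
  intro x y x' y' hx hx'
  rw [graph_conjugateOp hs, mem_conjugateGraph_iff hs] at hx hx'
  rw [hdec.inner_eq, hdec.inner_eq, hdec.inner_eq, ← Finset.sum_sub_distrib, Finset.mul_sum]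
  refine Finset.sum_congr rfl fun j _ => ?_
  rw [hdec.apply_directSumOp, diagComponent_laurent hA hs, diagComponent_laurent hA hs]
  exact branch_commutator hA hs hζ hcrit j (hx j) (hx' j)

theorem isSelfAdjoint_laurent (hA : Summable fun m => opNorm (A m))
    (hs : IsEigensystem (symbol A) lam W) : IsSelfAdjoint (laurent A) := by
  rw [(isDecomposition_diagComponent hs).eq_directSumOp (diagComponent_laurent hA hs)]
  exact isSelfAdjoint_directSumOp _ fun j =>
    isSelfAdjoint_mulOp (memLp_comp_eigenvalue hs j continuous_id)

theorem eigenMulOp_pow (hs : IsEigensystem (symbol A) lam W) (j : Fin N) (n : ℕ) :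
    eigenMulOp lam id j ^ n = eigenMulOp lam (fun x => x ^ n) j := by
  have hmem : ∀ f : ℝ → ℝ, Continuous f → MemLp (fun x => (f (lam j x) : ℂ)) ∞ haarT :=
    fun f hf => memLp_comp_eigenvalue hs j hf
  induction n with
  | zero =>
    simp only [pow_zero, eigenMulOp, Complex.ofReal_one]
    rw [mulOp_const, one_smul]
  | succ n ih =>
    rw [pow_succ, ih]
    simp only [eigenMulOp]
    rw [mulOp_mul (hmem (fun x => x ^ n) (by fun_prop)) (hmem id continuous_id)]
    simp only [id, pow_succ, Complex.ofReal_mul]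

/-- This identifies the direct sum of the multiplications by `ζ(λ_j)` as `ζ(H₀)`, in the form that
the compactness argument uses. -/
theorem exists_isFunctionOf_laurent (hA : Summable fun m => opNorm (A m))
    (hs : IsEigensystem (symbol A) lam W) (hζ : Continuous ζ) :
    ∃ R₀ : ℝ, ∀ R, R₀ ≤ R →
      IsFunctionOf (directSumOp (diagComponent W) (eigenMulOp lam ζ)) (laurent A) ζ R := by
  choose C hC using exists_bound_eigenvalue hs
  -- The sum is a convenient common bound for all the branches.
  refine ⟨∑ j, |C j|, fun R hR => ?_⟩
  refine (isDecomposition_diagComponent hs).isFunctionOf_directSumOp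
    (diagComponent_laurent hA hs) fun j p δ hδ hp => ?_
  have hCR : C j ≤ R :=
    (le_abs_self _).trans ((Finset.single_le_sum (fun k _ => abs_nonneg (C k))
      (Finset.mem_univ j)).trans hR)
  have e : eigenMulOp lam (fun x => p.eval x) j - eigenMulOp lam ζ j
      = eigenMulOp lam (fun x => p.eval x - ζ x) j := by
    rw [sub_eq_iff_eq_add]
    simp only [eigenMulOp]
    rw [mulOp_add (memLp_comp_eigenvalue hs j (f := fun x => p.eval x - ζ x)
      (p.continuous.sub hζ)) (memLp_comp_eigenvalue hs j hζ)]
    simp only [Complex.ofReal_sub, sub_add_cancel]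
  have hmem : ∀ f : ℝ → ℝ, Continuous f → MemLp (fun x => (f (lam j x) : ℂ)) ∞ haarT :=
    fun f hf => memLp_comp_eigenvalue hs j hf
  rw [aeval_eq_of_monomial (M := fun p => eigenMulOp lam (fun x => p.eval x) j)
    (fun p q => ?_) (fun n a => ?_) p, e]
  rotate_left
  · simp only [eigenMulOp]
    rw [mulOp_add (hmem (fun x => p.eval x) p.continuous) (hmem (fun x => q.eval x) q.continuous)]
    simp only [Polynomial.eval_add, Complex.ofReal_add]
  · rw [eigenMulOp_pow hs]
    simp only [eigenMulOp]
    rw [mulOp_smul (hmem (fun x => x ^ n) (by fun_prop))]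
    simp only [Polynomial.eval_monomial, Complex.ofReal_mul]
  refine norm_mulOp_le hδ (ae_torus_of_Ioo fun q hq => ?_)
  rw [Complex.norm_real]
  exact hp _ (abs_le.1 ((hC j q hq).trans hCR))

end Conjugate

theorem IsCommutator.add {E : Type*} [NormedAddCommGroup E] [InnerProductSpace ℂ E]
    {A : E →ₗ.[ℂ] E} {S S' C C' : E →L[ℂ] E} (h : IsCommutator A S C) (h' : IsCommutator A S' C') :
    IsCommutator A (S + S') (C + C') := by
  intro φ ψ
  simp only [add_apply, inner_add_right, h φ ψ, h' φ ψ]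
  ring

end BlockLaurent

/-! ### The Mourre estimate and the finiteness of the eigenvalues. -/

theorem mainTheorem8 (N : ℕ) (hN : 1 ≤ N)
    -- the Laurent operator and its symbol
    (A : ℤ → BlockLaurent.Mat N)
    (hsum : Summable fun m => BlockLaurent.opNorm (A m))
    (hherm : ∀ m, A (-m) = (A m).conjTranspose)
    (hhol : BlockLaurent.HasHolomorphicExtension (BlockLaurent.symbol A))
    -- the eigenvalues and eigenvectors of the symbol
    (lam : Fin N → BlockLaurent.Torus → ℝ)
    (W : Fin N → BlockLaurent.Torus → BlockLaurent.Vec N)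
    (hsys : BlockLaurent.IsEigensystem (BlockLaurent.symbol A) lam W)
    -- the compact interval `Δ = [a, b]`, the open interval `I` and the cut-off function `ζ`
    (a b : ℝ) (hab : a ≤ b)
    (hΔ : Disjoint (Icc a b) (BlockLaurent.criticalSet lam))
    (I : Set ℝ) (hIo : IsOpen I) (hIc : I.OrdConnected) (hΔI : Icc a b ⊆ I)
    (hI : Disjoint (closure I) (BlockLaurent.criticalSet lam))
    (ζ : ℝ → ℝ) (hζ : ContDiff ℝ ∞ ζ) (hζI : tsupport ζ ⊆ closure I)
    (hζΔ : ∀ x ∈ Icc a b, ζ x = 1)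
    -- the perturbation
    (V : BlockLaurent.Seq N →L[ℂ] BlockLaurent.Seq N)
    (hVsa : IsSelfAdjoint V) (hVc : IsCompactOperator V)
    (hV1 : BlockLaurent.IsOfClassC1 (BlockLaurent.conjugateOp lam W ζ) V)
    (B : BlockLaurent.Seq N →L[ℂ] BlockLaurent.Seq N)
    (hB : BlockLaurent.IsCommutator (BlockLaurent.conjugateOp lam W ζ) V B)
    (hBc : IsCompactOperator B) :
    IsSelfAdjoint (BlockLaurent.conjugateOp lam W ζ) ∧
    (∃ C : BlockLaurent.Seq N →L[ℂ] BlockLaurent.Seq N,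
      BlockLaurent.IsCommutator (BlockLaurent.conjugateOp lam W ζ)
        (BlockLaurent.laurent A + V) C ∧
      ∃ K : BlockLaurent.Seq N →L[ℂ] BlockLaurent.Seq N, IsCompactOperator K ∧
        BlockLaurent.spectralProj (BlockLaurent.laurent A + V) (Icc a b) * C *
            BlockLaurent.spectralProj (BlockLaurent.laurent A + V) (Icc a b) =
          BlockLaurent.spectralProj (BlockLaurent.laurent A + V) (Icc a b) + K) ∧
    {μ : ℝ | μ ∈ Icc a b ∧ Module.End.HasEigenvalue
      (BlockLaurent.laurent A + V : BlockLaurent.Seq N →L[ℂ] BlockLaurent.Seq N).toLinearMap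
      (μ : ℂ)}.Finite ∧
    ∀ μ ∈ Icc a b, FiniteDimensional ℂ (Module.End.eigenspace
      (BlockLaurent.laurent A + V : BlockLaurent.Seq N →L[ℂ] BlockLaurent.Seq N).toLinearMap
      ((μ : ℝ) : ℂ)) := by
  have hcrit : Disjoint (tsupport ζ) (BlockLaurent.criticalSet lam) := hI.mono_left hζI
  have hA := BlockLaurent.isSelfAdjoint_conjugateOp hsum hsys hζ hcrit
  have hH : IsSelfAdjoint (BlockLaurent.laurent A + V) :=
    (BlockLaurent.isSelfAdjoint_laurent hsum hsys).add hVsa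
  have hC := (BlockLaurent.isCommutator_laurent hsum hsys hζ hcrit).add hB
  obtain ⟨R₀, hR₀⟩ := BlockLaurent.exists_isFunctionOf_laurent hsum hsys hζ.continuous
  -- The radius is the maximum of `R₀` and `‖H‖`, so one interval serves both `ζ(H₀)` and `ζ(H)`.
  have hZ := (hR₀ _ (le_max_left R₀ ‖BlockLaurent.laurent A + V‖)).isCompactOperator_sub hVc
    hζ.continuous (BlockLaurent.isFunctionOf_cfc hH hζ.continuous (le_max_right _ _))
  obtain ⟨K, hK, hM⟩ := BlockLaurent.exists_compact_mourre hH hζ.continuous hζΔ hZ hBc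
  exact ⟨hA, ⟨_, hC, K, hK, hM⟩, BlockLaurent.finite_eigenvalues_of_mourre hH hK hM
    fun μ ψ hψ => BlockLaurent.inner_commutator_eq_zero hA hH hC hψ⟩
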